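/- Let $K$ be a field, let $n_1<n_2<n_3<n_4$ be positive integers with $\gcd(n_1,\dots,n_4)=1$, let $C$ be the monomial curve $x_i=t^{n_i}$ in $\mathbb A^4(K)$, and let $I(C)$ be the kernel of $K[x_1,\dots,x_4]\to K[t]$, $x_i\mapsto t^{n_i}$. For $f\ne 0$ let $f_*$ be the homogeneous summand of $f$ of least degree, and let $I(C)_*$ be the ideal generated by all $f_*$ with $0\ne f\in I(C)$, so that $K[x_1,\dots,x_4]/I(C)_*$ is the coordinate ring of the tangent cone of $C$ at the origin. Suppose that $I(C)$ is minimally generated (no generator can be omitted) by $$f_1=x_1^{a_1}-x_3^{a_{13}}x_4^{a_{14}},\quad f_2=x_2^{a_2}-x_1^{a_{21}}x_3^{a_{23}},\quad f_3=x_3^{a_3}-x_2^{a_{32}}x_4^{a_{34}},$$ $$f_4=x_4^{a_4}-x_1^{a_{41}}x_2^{a_{42}},\quad f_5=x_1^{a_{21}}x_4^{a_{34}}-x_2^{a_{42}}x_3^{a_{13}},$$ where $0<a_{ij}<a_j$ for all exponents $a_{ij}$ that occur. Assume $$a_{21}+a_{34}<a_{42}+a_{13},\quad a_{14}\le a_{34},\quad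 a_2\le a_{21}+a_{23},\quad a_{32}+a_{34}\le a_3,\quad a_3+a_{13}\le a_1+a_{32}+a_{34}-a_{14},$$ and put $$f_6=x_3^{a_3+a_{13}}-x_1^{a_1}x_2^{a_{32}}x_4^{a_{34}-a_{14}},\qquad f_7=x_1^{a_1+a_{21}}x_4^{a_{34}-a_{14}}-x_2^{a_{42}}x_3^{2a_{13}}.$$ **(A)** $\{f_1,\dots,f_7\}$ is a standard basis of $I(C)$ with respect to the negative degree reverse lexicographic ordering with $x_4>x_2>x_3>x_1$; that is, the leading monomials of $f_1,\dots,f_7$ generate the ideal generated by the leading monomials of all nonzero elements of $I(C)$. **(B)** $I(C)_*$ is minimally generated by the following seven elements: 1. if $a_2<a_{21}+a_{23}$, $a_{32}+a_{34}<a_3$ and $a_3+a_{13}<a_1+a_{32}+a_{34}-a_{14}$: $\ x_3^{a_{13}}x_4^{a_{14}},\ x_2^{a_2},\ x_2^{a_{32}}x_4^{a_{34}},\ x_4^{a_4},\ x_1^{a_{21}}x_4^{a_{34}},\ x_3^{a_3+a_{13}},\ x_2^{a_{42}}x_3^{2a_{13}}$; 2. if $a_2<a_{21}+a_{23}$, $a_{32}+a_{34}<a_3$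 and $a_3+a_{13}=a_1+a_{32}+a_{34}-a_{14}$: $\ x_3^{a_{13}}x_4^{a_{14}},\ x_2^{a_2},\ x_2^{a_{32}}x_4^{a_{34}},\ x_4^{a_4},\ x_1^{a_{21}}x_4^{a_{34}},\ f_6,\ x_2^{a_{42}}x_3^{2a_{13}}$; 3. if $a_2<a_{21}+a_{23}$, $a_{32}+a_{34}=a_3$ and $a_3+a_{13}<a_1+a_{32}+a_{34}-a_{14}$: $\ x_3^{a_{13}}x_4^{a_{14}},\ x_2^{a_2},\ f_3,\ x_4^{a_4},\ x_1^{a_{21}}x_4^{a_{34}},\ x_3^{a_3+a_{13}},\ x_2^{a_{42}}x_3^{2a_{13}}$; 4. if $a_2<a_{21}+a_{23}$, $a_{32}+a_{34}=a_3$ and $a_3+a_{13}=a_1+a_{32}+a_{34}-a_{14}$: $\ x_3^{a_{13}}x_4^{a_{14}},\ x_2^{a_2},\ f_3,\ x_4^{a_4},\ x_1^{a_{21}}x_4^{a_{34}},\ f_6,\ x_2^{a_{42}}x_3^{2a_{13}}$; 5. if $a_2=a_{21}+a_{23}$, $a_{32}+a_{34}<a_3$ and $a_3+a_{13}<a_1+a_{32}+a_{34}-a_{14}$: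 $\ x_3^{a_{13}}x_4^{a_{14}},\ f_2,\ x_2^{a_{32}}x_4^{a_{34}},\ x_4^{a_4},\ x_1^{a_{21}}x_4^{a_{34}},\ x_3^{a_3+a_{13}},\ x_2^{a_{42}}x_3^{2a_{13}}$; 6. if $a_2=a_{21}+a_{23}$, $a_{32}+a_{34}<a_3$ and $a_3+a_{13}=a_1+a_{32}+a_{34}-a_{14}$: $\ x_3^{a_{13}}x_4^{a_{14}},\ f_2,\ x_2^{a_{32}}x_4^{a_{34}},\ x_4^{a_4},\ x_1^{a_{21}}x_4^{a_{34}},\ f_6,\ f_7$; 7. if $a_2=a_{21}+a_{23}$, $a_{32}+a_{34}=a_3$ and $a_3+a_{13}<a_1+a_{32}+a_{34}-a_{14}$: $\ x_3^{a_{13}}x_4^{a_{14}},\ f_2,\ f_3,\ x_4^{a_4},\ x_1^{a_{21}}x_4^{a_{34}},\ x_3^{a_3+a_{13}},\ x_2^{a_{42}}x_3^{2a_{13}}$; 8. if $a_2=a_{21}+a_{23}$, $a_{32}+a_{34}=a_3$ and $a_3+a_{13}=a_1+a_{32}+a_{34}-a_{14}$: $\ x_3^{a_{13}}x_4^{a_{14}},\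 f_2,\ f_3,\ x_4^{a_4},\ x_1^{a_{21}}x_4^{a_{34}},\ f_6,\ f_7$. **(C)** The minimal number of generators of $I(C)_*$ is $7$, and the tangent cone is not Cohen–Macaulay, i.e. $K[x_1,\dots,x_4]/I(C)_*$ is not a Cohen–Macaulay ring. -/

import Mathlib

open MvPolynomial

/-! ### Toric ideals of monomial curves and their tangent cones -/

/-- The toric ideal of the monomial curve `x_i = t ^ (n i)`: the kernel of the `K`-algebra
homomorphism `K[x_i] → K[t]`, `x_i ↦ t ^ (n i)`. -/
noncomputable def toricIdeal (K : Type*) [Field K] {σ : Type*} (n : σ → ℕ) :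
    Ideal (MvPolynomial σ K) :=
  RingHom.ker (aeval (fun i => (Polynomial.X : Polynomial K) ^ n i) :
    MvPolynomial σ K →ₐ[K] Polynomial K)

/-- The least degree of a nonzero homogeneous summand of `f` (and `0` for `f = 0`). -/
noncomputable def leastDegree {K : Type*} [Field K] {σ : Type*} (f : MvPolynomial σ K) : ℕ :=
  sInf {d : ℕ | homogeneousComponent d f ≠ 0}

/-- `f_*`, the homogeneous summand of `f` of least degree. -/
noncomputable def initialForm {K : Type*} [Field K] {σ : Type*} (f : MvPolynomial σ K) :
    MvPolynomial σ K :=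
  homogeneousComponent (leastDegree f) f

/-- `I_*`, the ideal generated by the forms `f_*` with `f ∈ I`. For the ideal of a curve through
the origin it is the defining ideal of the tangent cone at the origin. -/
noncomputable def initialFormIdeal {K : Type*} [Field K] {σ : Type*}
    (I : Ideal (MvPolynomial σ K)) : Ideal (MvPolynomial σ K) :=
  Ideal.span (initialForm '' (I : Set (MvPolynomial σ K)))

/-- The family `g` minimally generates the ideal `I`: it generates `I`, and no member may be
omitted. (In particular the members are pairwise distinct.) -/
def MinimallyGenerates {R : Type*} [CommRing R] {ι : Type*} (g : ι → R) (I : Ideal R) : Prop :=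
  Ideal.span (Set.range g) = I ∧ ∀ i, g i ∉ Ideal.span (g '' {j | j ≠ i})

/-! ### Standard bases -/

/-- `x^α < x^β` in the negative degree reverse lexicographic ordering in which the variable `x_i`
is greater than `x_j` when `rank i < rank j`: either `deg x^α > deg x^β`, or the degrees agree and,
for the smallest variable in which the exponents differ, `x^α` has the greater exponent. -/
def NegDegRevLexLT {σ : Type*} (rank : σ → ℕ) (α β : σ →₀ ℕ) : Prop :=
  β.degree < α.degree ∨
    (α.degree = β.degree ∧ ∃ i, β i < α i ∧ ∀ j, rank i < rank j → α j = β j)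

/-- `m` is the exponent of the leading (i.e. greatest) monomial of `f` for the strict ordering
`lt` of monomials. -/
def IsLeadingExponent {K : Type*} [Field K] {σ : Type*} (lt : (σ →₀ ℕ) → (σ →₀ ℕ) → Prop)
    (f : MvPolynomial σ K) (m : σ →₀ ℕ) : Prop :=
  m ∈ f.support ∧ ∀ m' ∈ f.support, m' ≠ m → lt m' m

/-- The leading ideal of a set of polynomials: the ideal generated by the leading monomials of its
nonzero elements. -/
noncomputable def leadingIdeal {K : Type*} [Field K] {σ : Type*}
    (lt : (σ →₀ ℕ) → (σ →₀ ℕ) → Prop) (S : Set (MvPolynomial σ K)) : Ideal (MvPolynomial σ K) :=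
  Ideal.span {p | ∃ f ∈ S, ∃ m, IsLeadingExponent lt f m ∧ p = monomial m 1}

/-- `G` is a standard basis of `I` for the ordering `lt`: it is a finite subset of `I` with the
same leading ideal. (For a local ordering, passing to the localization at the origin changes
neither leading ideal, because each fraction has a unit multiple `g` in `I` with the same
leading monomial.) -/
def IsStandardBasis {K : Type*} [Field K] {σ : Type*} (lt : (σ →₀ ℕ) → (σ →₀ ℕ) → Prop)
    (G : Set (MvPolynomial σ K)) (I : Ideal (MvPolynomial σ K)) : Prop :=
  G.Finite ∧ G ⊆ I ∧ leadingIdeal lt G = leadingIdeal lt (I : Set (MvPolynomial σ K))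

/-! ### Cohen-Macaulay rings -/

/-- A local ring is Cohen-Macaulay if it has a regular sequence whose length is its Krull
dimension. (A regular sequence on a local ring lies in the maximal ideal, since it generates a
proper ideal.) To be used for Noetherian rings. -/
def IsCohenMacaulayLocal (R : Type*) [CommRing R] [IsLocalRing R] : Prop :=
  ∃ rs : List R, RingTheory.Sequence.IsRegular R rs ∧
    ((rs.length : ℕ∞) : WithBot ℕ∞) = ringKrullDim R

/-- A (Noetherian) ring is Cohen-Macaulay if its localizations at prime ideals are. -/
def IsCohenMacaulay (R : Type*) [CommRing R] : Prop :=
  ∀ (p : Ideal R) [p.IsPrime], IsCohenMacaulayLocal (Localization.AtPrime p)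

/-! ### The family of curves -/

/-- The exponents occurring in the generators of the toric ideal. -/
structure CurveExponents where
  a1 : ℕ
  a2 : ℕ
  a3 : ℕ
  a4 : ℕ
  a13 : ℕ
  a14 : ℕ
  a21 : ℕ
  a23 : ℕ
  a32 : ℕ
  a34 : ℕ
  a41 : ℕ
  a42 : ℕ

namespace CurveExponents

/-- The conditions `0 < a_ij < a_j`. -/
structure Admissible (a : CurveExponents) : Prop where
  h13 : 0 < a.a13 ∧ a.a13 < a.a3
  h14 : 0 < a.a14 ∧ a.a14 < a.a4
  h21 : 0 < a.a21 ∧ a.a21 < a.a1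
  h23 : 0 < a.a23 ∧ a.a23 < a.a3
  h32 : 0 < a.a32 ∧ a.a32 < a.a2
  h34 : 0 < a.a34 ∧ a.a34 < a.a4
  h41 : 0 < a.a41 ∧ a.a41 < a.a1
  h42 : 0 < a.a42 ∧ a.a42 < a.a2

variable (K : Type*) [Field K] (a : CurveExponents)

/-! The variables `x_1, x_2, x_3, x_4` are `X 0, X 1, X 2, X 3`. -/

/-- `f_1 = x_1^{a_1} - x_3^{a_13} x_4^{a_14}`. -/
noncomputable def f1 : MvPolynomial (Fin 4) K := X 0 ^ a.a1 - X 2 ^ a.a13 * X 3 ^ a.a14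

/-- `f_2 = x_2^{a_2} - x_1^{a_21} x_3^{a_23}`. -/
noncomputable def f2 : MvPolynomial (Fin 4) K := X 1 ^ a.a2 - X 0 ^ a.a21 * X 2 ^ a.a23

/-- `f_3 = x_3^{a_3} - x_2^{a_32} x_4^{a_34}`. -/
noncomputable def f3 : MvPolynomial (Fin 4) K := X 2 ^ a.a3 - X 1 ^ a.a32 * X 3 ^ a.a34

/-- `f_4 = x_4^{a_4} - x_1^{a_41} x_2^{a_42}`. -/
noncomputable def f4 : MvPolynomial (Fin 4) K := X 3 ^ a.a4 - X 0 ^ a.a41 * X 1 ^ a.a42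

/-- `f_5 = x_1^{a_21} x_4^{a_34} - x_2^{a_42} x_3^{a_13}`. -/
noncomputable def f5 : MvPolynomial (Fin 4) K :=
  X 0 ^ a.a21 * X 3 ^ a.a34 - X 1 ^ a.a42 * X 2 ^ a.a13

/-- `f_6 = x_3^{a_3 + a_13} - x_1^{a_1} x_2^{a_32} x_4^{a_34 - a_14}`
(used when `a_14 ≤ a_34`). -/
noncomputable def f6 : MvPolynomial (Fin 4) K :=
  X 2 ^ (a.a3 + a.a13) - X 0 ^ a.a1 * X 1 ^ a.a32 * X 3 ^ (a.a34 - a.a14)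

/-- `f_7 = x_1^{a_1 + a_21} x_4^{a_34 - a_14} - x_2^{a_42} x_3^{2 a_13}`
(used when `a_14 ≤ a_34`). -/
noncomputable def f7 : MvPolynomial (Fin 4) K :=
  X 0 ^ (a.a1 + a.a21) * X 3 ^ (a.a34 - a.a14) - X 1 ^ a.a42 * X 2 ^ (2 * a.a13)

end CurveExponents

/-- The toric ideal of the curve `x_i = t ^ (n i)` is minimally generated by the binomials
`f_1, …, f_5` with exponents `a`, where `0 < a_ij < a_j`. -/
structure HasToricGenerators (K : Type*) [Field K] (n : Fin 4 → ℕ) (a : CurveExponents) :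
    Prop where
  admissible : a.Admissible
  minimallyGenerates :
    MinimallyGenerates ![a.f1 K, a.f2 K, a.f3 K, a.f4 K, a.f5 K] (toricIdeal K n)

/-! A polynomial lies in a toric ideal exactly when its coefficients in each weight add up to zero,
so everything is decided by pairs of monomials of equal weight. Read f_1, …, f_7 as rewriting rules
`lead i` → `tail i`. A rule keeps the weight and goes down in the ordering, and each weight has only
finitely many monomials, so rewriting stops at a standard monomial, one divisible by no leading
monomial. If no two standard monomials share a weight, normal forms are unique. This gives both the
standard basis (`isStandardBasis_of_injOn`) and the generation of I(C)_* by the seven initial forms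
(`span_range_eq_initialFormIdeal_of_injOn`), without reducing S-polynomials.

Uniqueness (`eq_of_standard`) is where f_1, …, f_5 enter. By `transfer`, a monomial ideal containing
their ten terms contains all or none of the monomials of a given weight. Suitable monomial ideals
yield the exponent relations and the lemmas `le_of_pure_*` and `dvd_of_*`. Two standard monomials of
equal weight may be taken coprime; trading a forced power for the other term of its generator and
cancelling leads to a pair that violates these lemmas.

For minimality, no leading exponent is divisible by any other exponent of the initial forms, so the
coefficients at the seven leading exponents separate the generators modulo 𝔪·I(C)_*. The cone is not
Cohen–Macaulay because x_4^{a_34} is nonzero locally at the origin but killed by powers of all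
variables (depth 0), while the cone contains the x_1-axis (positive dimension). -/

/-! ### Polynomials vanishing on a set of exponents closed under division -/

section General

variable {K : Type*} [Field K] {σ : Type*}

/-- If the coefficients of the generators of an ideal vanish on a set of exponents that is closed
under division, then so do the coefficients of all its elements. -/
theorem coeff_eq_zero_of_mem_span {D : (σ →₀ ℕ) → Prop} (hD : ∀ α β, D (α + β) → D β)
    {S : Set (MvPolynomial σ K)} (hS : ∀ g ∈ S, ∀ β, D β → coeff β g = 0)
    {f : MvPolynomial σ K} (hf : f ∈ Ideal.span S) {β : σ →₀ ℕ} (hβ : D β) : coeff β f = 0 := by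
  classical
  induction hf using Submodule.span_induction generalizing β with
  | mem g hg => exact hS g hg β hβ
  | zero => simp
  | add x y _ _ hx hy => rw [coeff_add, hx hβ, hy hβ, add_zero]
  | smul q x _ hx =>
    rw [smul_eq_mul, coeff_mul]
    refine Finset.sum_eq_zero fun y hy => ?_
    rw [Finset.HasAntidiagonal.mem_antidiagonal] at hy
    rw [hx (hD y.1 y.2 (hy ▸ hβ)), mul_zero]

theorem aeval_monomial_pow (n : σ → ℕ) (α : σ →₀ ℕ) (c : K) :
    aeval (fun i => (Polynomial.X : Polynomial K) ^ n i) (monomial α c) =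
      Polynomial.monomial (Finsupp.weight n α) c := by
  rw [aeval_monomial, Finsupp.weight_apply, Finsupp.prod, Finsupp.sum]
  simp_rw [← pow_mul]
  rw [Finset.prod_pow_eq_pow_sum, ← Polynomial.C_eq_algebraMap, Polynomial.C_mul_X_pow_eq_monomial]
  congr 2
  exact Finset.sum_congr rfl fun i _ => by rw [smul_eq_mul, mul_comm]

theorem monomial_sub_monomial_mem_toricIdeal {n : σ → ℕ} {α β : σ →₀ ℕ} :
    monomial α (1 : K) - monomial β 1 ∈ toricIdeal K n ↔
      Finsupp.weight n α = Finsupp.weight n β := by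
  rw [toricIdeal, RingHom.mem_ker, map_sub, aeval_monomial_pow, aeval_monomial_pow, sub_eq_zero]
  exact Polynomial.monomial_left_inj one_ne_zero

/-- The coefficients of an element of the toric ideal in each weight add up to zero. -/
theorem sum_coeff_eq_zero_of_mem_toricIdeal {n : σ → ℕ} {f : MvPolynomial σ K}
    (hf : f ∈ toricIdeal K n) (w : ℕ) :
    ∑ α ∈ f.support with Finsupp.weight n α = w, coeff α f = 0 := by
  rw [toricIdeal, RingHom.mem_ker] at hf
  have h := congrArg (fun p => Polynomial.coeff p w) hf
  simp only [Polynomial.coeff_zero] at h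
  conv_lhs at h => rw [f.as_sum, map_sum, Polynomial.finsetSum_coeff]
  refine (Finset.sum_filter _ _).trans (Eq.trans ?_ h)
  refine Finset.sum_congr rfl fun α _ => ?_
  rw [aeval_monomial_pow, Polynomial.coeff_monomial]

/-! ### The ideal of initial forms of a toric ideal -/

theorem leastDegree_le {f : MvPolynomial σ K} {α : σ →₀ ℕ} (hα : α ∈ f.support) :
    leastDegree f ≤ α.degree := by
  refine Nat.sInf_le fun h => ?_
  have := congrArg (coeff α) h
  rw [coeff_homogeneousComponent, if_pos rfl, coeff_zero] at this
  exact mem_support_iff.mp hα this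

theorem leastDegree_eq {f : MvPolynomial σ K} {α : σ →₀ ℕ} (hα : α ∈ f.support)
    (h : ∀ β ∈ f.support, α.degree ≤ β.degree) : leastDegree f = α.degree := by
  refine le_antisymm (leastDegree_le hα) (le_csInf ⟨α.degree, fun h => ?_⟩ fun d hd => ?_)
  · have := congrArg (coeff α) h
    rw [coeff_homogeneousComponent, if_pos rfl, coeff_zero] at this
    exact mem_support_iff.mp hα this
  · obtain ⟨β, hβ⟩ := MvPolynomial.ne_zero_iff.mp hd
    rw [coeff_homogeneousComponent] at hβ
    split_ifs at hβ with hd'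
    · exact hd' ▸ h β (mem_support_iff.mpr hβ)
    · exact absurd rfl hβ

theorem homogeneousComponent_monomial (d : ℕ) (α : σ →₀ ℕ) (c : K) :
    homogeneousComponent d (monomial α c) = if α.degree = d then monomial α c else 0 := by
  classical
  ext β
  rw [coeff_homogeneousComponent]
  split_ifs with h1 h2 h2 <;> simp only [coeff_monomial, coeff_zero]
  · split_ifs with h
    · exact absurd (h ▸ h1) h2
    · rfl
  · split_ifs with h
    · exact absurd (h ▸ h2) h1
    · rfl

theorem initialForm_monomial_sub_monomial {α β : σ →₀ ℕ} (hne : α ≠ β)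
    (hd : α.degree ≤ β.degree) :
    initialForm (monomial α (1 : K) - monomial β 1) =
      if β.degree = α.degree then monomial α 1 - monomial β 1 else monomial α 1 := by
  classical
  have hl : leastDegree (monomial α (1 : K) - monomial β 1) = α.degree := by
    refine leastDegree_eq ?_ fun γ hγ => ?_
    · rw [mem_support_iff, coeff_sub, coeff_monomial, coeff_monomial, if_pos rfl,
        if_neg hne.symm, sub_zero]
      exact one_ne_zero
    · rw [mem_support_iff, coeff_sub, coeff_monomial, coeff_monomial] at hγ
      by_cases h1 : α = γ
      · rw [h1]
      · by_cases h2 : β = γ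
        · exact h2 ▸ hd
        · rw [if_neg h1, if_neg h2, sub_zero] at hγ
          exact absurd rfl hγ
  rw [initialForm, hl, map_sub, homogeneousComponent_monomial, homogeneousComponent_monomial,
    if_pos rfl]
  split_ifs <;> simp

theorem monomial_sub_monomial_mem_initialFormIdeal {n : σ → ℕ} {α β : σ →₀ ℕ}
    (hw : Finsupp.weight n α = Finsupp.weight n β) (hd : α.degree = β.degree) :
    monomial α (1 : K) - monomial β 1 ∈ initialFormIdeal (toricIdeal K n) := by
  by_cases hne : α = β
  · rw [hne, sub_self]; exact zero_mem _
  · refine Ideal.subset_span ⟨_, monomial_sub_monomial_mem_toricIdeal.mpr hw, ?_⟩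
    rw [initialForm_monomial_sub_monomial hne hd.le, if_pos hd.symm]

theorem monomial_mem_initialFormIdeal {n : σ → ℕ} {α β : σ →₀ ℕ}
    (hw : Finsupp.weight n α = Finsupp.weight n β) (hd : α.degree < β.degree) :
    monomial α (1 : K) ∈ initialFormIdeal (toricIdeal K n) := by
  refine Ideal.subset_span ⟨_, monomial_sub_monomial_mem_toricIdeal.mpr hw, ?_⟩
  rw [initialForm_monomial_sub_monomial (fun h => hd.ne (congrArg _ h)) hd.le, if_neg hd.ne']

/-- The ideal of initial forms of a toric ideal is generated by monomials and homogeneous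
binomials. -/
theorem initialFormIdeal_toricIdeal_le {n : σ → ℕ} {J : Ideal (MvPolynomial σ K)}
    (h₁ : ∀ α β : σ →₀ ℕ, Finsupp.weight n α = Finsupp.weight n β → α.degree = β.degree →
      monomial α (1 : K) - monomial β 1 ∈ J)
    (h₂ : ∀ α β : σ →₀ ℕ, Finsupp.weight n α = Finsupp.weight n β → α.degree < β.degree →
      monomial α (1 : K) ∈ J) :
    initialFormIdeal (toricIdeal K n) ≤ J := by
  classical
  refine Ideal.span_le.mpr ?_
  rintro _ ⟨f, hf, rfl⟩
  have hC : ∀ (α : σ →₀ ℕ) (c : K), monomial α c = C c * monomial α 1 := fun α c => by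
    rw [C_mul_monomial, mul_one]
  rw [SetLike.mem_coe, initialForm, homogeneousComponent_apply]
  rw [← Finset.sum_fiberwise_of_maps_to (g := Finsupp.weight n)
    (t := f.support.image (Finsupp.weight n))
    (fun α hα => Finset.mem_image_of_mem _ (Finset.mem_filter.mp hα).1)]
  refine Ideal.sum_mem _ fun w _ => ?_
  -- Either the weight-w part of f also reaches a higher degree, and `h₂` covers each of its lowest
  -- monomials, or it lies wholly in the least degree.
  by_cases hw : ∃ β ∈ f.support, Finsupp.weight n β = w ∧ leastDegree f < β.degree
  · obtain ⟨β, -, hβw, hβd⟩ := hw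
    refine Ideal.sum_mem _ fun α hα => ?_
    rw [Finset.mem_filter, Finset.mem_filter] at hα
    rw [hC]
    exact Ideal.mul_mem_left _ _ (h₂ α β (hα.2.trans hβw.symm) (hα.1.2.trans_lt hβd))
  · push Not at hw
    have hs : (f.support.filter fun α => α.degree = leastDegree f).filter
        (fun α => Finsupp.weight n α = w) =
        f.support.filter fun α => Finsupp.weight n α = w := by
      ext α
      simp only [Finset.mem_filter]
      exact ⟨fun h => ⟨h.1.1, h.2⟩,
        fun h => ⟨⟨h.1, le_antisymm (hw α h.1 h.2) (leastDegree_le h.1)⟩, h.2⟩⟩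
    rcases (f.support.filter fun α => Finsupp.weight n α = w).eq_empty_or_nonempty with he | ⟨γ, hγ⟩
    · rw [hs, he, Finset.sum_empty]; exact zero_mem _
    · have hγ' := hγ
      rw [← hs, Finset.mem_filter, Finset.mem_filter] at hγ'
      -- Subtracting this zero multiple of the monomial γ turns the part into a combination of
      -- differences covered by `h₁`.
      have h0 : ∑ α ∈ f.support with Finsupp.weight n α = w, monomial γ (coeff α f) = 0 := by
        rw [← map_sum, sum_coeff_eq_zero_of_mem_toricIdeal hf, map_zero]
      rw [← sub_zero (Finset.sum _ _), ← h0, hs, ← Finset.sum_sub_distrib, ← hs]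
      refine Ideal.sum_mem _ fun α hα => ?_
      rw [Finset.mem_filter, Finset.mem_filter] at hα
      rw [hC, hC γ, ← mul_sub]
      exact Ideal.mul_mem_left _ _
        (h₁ α γ (hα.2.trans hγ'.2.symm) (hα.1.2.trans hγ'.1.2.symm))

end General

/-! ### Minimal generation detected on exponents -/

section MinimalGenerators

variable {K : Type*} [Field K] {σ ι : Type*}

/-- If each `g i` has an exponent `e i` such that no exponent of any `g j`, other than `e i` as an
exponent of `g i`, divides `e i`, then no `g i` lies in the ideal generated by the others. -/
theorem notMem_span_of_exponents {g : ι → MvPolynomial σ K} {e : ι → σ →₀ ℕ}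
    (h0 : ∀ i, coeff (e i) (g i) ≠ 0) (h : ∀ i j, j ≠ i → ∀ β ≤ e i, coeff β (g j) = 0) (i : ι) :
    g i ∉ Ideal.span (g '' {j | j ≠ i}) := fun hi => by
  refine h0 i (coeff_eq_zero_of_mem_span (D := fun β => β ≤ e i)
    (fun α β hαβ => le_add_self.trans hαβ) ?_ hi le_rfl)
  rintro _ ⟨j, hj, rfl⟩ β hβ
  exact h i j hj β hβ

/-- Under the same conditions, the ideal cannot be generated by fewer elements. -/
theorem spanFinrank_span_range_eq_card [Fintype ι] {g : ι → MvPolynomial σ K} {e : ι → σ →₀ ℕ}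
    (h0 : ∀ i, coeff (e i) (g i) ≠ 0) (h : ∀ i j, j ≠ i → ∀ β ≤ e i, coeff β (g j) = 0)
    (h1 : ∀ i, ∀ β < e i, coeff β (g i) = 0) :
    (Ideal.span (Set.range g)).spanFinrank = Fintype.card ι := by
  classical
  have hfin : (Set.range g).Finite := Set.finite_range g
  have hlt : ∀ p ∈ Ideal.span (Set.range g), ∀ i, ∀ β < e i, coeff β p = 0 := by
    intro p hp i β hβ
    refine coeff_eq_zero_of_mem_span (D := fun β => β < e i)
      (fun α β hαβ => lt_of_le_of_lt le_add_self hαβ) ?_ hp hβ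
    rintro _ ⟨j, rfl⟩ γ hγ
    by_cases hj : j = i
    · subst hj; exact h1 j γ hγ
    · exact h i j hj γ hγ.le
  -- Φ reads the coefficients at the e i. On the ideal, multiplication by q acts on Φ through the
  -- constant term of q, so Φ factors through I/𝔪I.
  let Φ : MvPolynomial σ K →ₗ[K] (ι → K) := LinearMap.pi fun i => lcoeff K (e i)
  have hΦ : ∀ p i, Φ p i = coeff (e i) p := fun p i => rfl
  have hmul : ∀ p ∈ Ideal.span (Set.range g), ∀ q, Φ (q * p) = constantCoeff q • Φ p := by
    intro p hp q
    ext i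
    rw [Pi.smul_apply, hΦ, hΦ, coeff_mul, smul_eq_mul]
    refine (Finset.sum_eq_single (0, e i) ?_ ?_).trans rfl
    · rintro ⟨x, y⟩ hxy hne
      rw [Finset.HasAntidiagonal.mem_antidiagonal] at hxy
      dsimp only at hxy ⊢
      have hy : y ≠ e i := by
        rintro rfl
        exact hne (Prod.ext (by simpa using hxy) rfl)
      rw [hlt p hp i y (lt_of_le_of_ne (hxy ▸ le_add_self) hy), mul_zero]
    · intro hn
      exact absurd (Finset.HasAntidiagonal.mem_antidiagonal.mpr (zero_add _)) hn
  refine le_antisymm ?_ ?_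
  · refine (Submodule.spanFinrank_span_le_ncard_of_finite hfin).trans ?_
    rw [← Set.image_univ, ← Nat.card_eq_fintype_card, ← Set.ncard_univ]
    exact Set.ncard_image_le (Set.toFinite _)
  · obtain ⟨s, hs, hspan⟩ := Submodule.FG.exists_span_finset_card_eq_spanFinrank
      (p := Ideal.span (Set.range g)) (Submodule.fg_span hfin)
    rw [← hs]
    have hsub : ∀ p ∈ Ideal.span (Set.range g),
        Φ p ∈ Submodule.span K ((s.image Φ : Finset (ι → K)) : Set (ι → K)) := by
      intro p hp
      have hsJ : ∀ x ∈ Submodule.span (MvPolynomial σ K) (s : Set (MvPolynomial σ K)),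
          x ∈ Ideal.span (Set.range g) := fun x hx => hspan ▸ hx
      rw [← hspan] at hp
      induction hp using Submodule.span_induction with
      | mem x hx => exact Submodule.subset_span (Finset.mem_coe.mpr (Finset.mem_image_of_mem _ hx))
      | zero => rw [map_zero]; exact zero_mem _
      | add x y _ _ hx hy => rw [map_add]; exact add_mem hx hy
      | smul q x hx' hx =>
        rw [smul_eq_mul, hmul x (hsJ x hx')]
        exact Submodule.smul_mem _ _ hx
    -- Φ (g i) is a nonzero multiple of the i-th basis vector, so the images of any generating set
    -- span K^ι.
    have htop : Submodule.span K ((s.image Φ : Finset (ι → K)) : Set (ι → K)) = ⊤ := by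
      rw [eq_top_iff, ← (Pi.basisFun K ι).span_eq, Submodule.span_le]
      rintro _ ⟨i, rfl⟩
      have hgi := hsub (g i) (Ideal.subset_span ⟨i, rfl⟩)
      have hΦi : Φ (g i) = coeff (e i) (g i) • Pi.basisFun K ι i := by
        ext j
        rw [Pi.smul_apply, hΦ, Pi.basisFun_apply, smul_eq_mul]
        by_cases hj : j = i
        · subst hj; rw [Pi.single_eq_same, mul_one]
        · rw [Pi.single_eq_of_ne hj, mul_zero, h j i (Ne.symm hj) _ le_rfl]
      rw [hΦi] at hgi
      exact (Submodule.smul_mem_iff _ (h0 i)).mp hgi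
    calc Fintype.card ι = Module.finrank K (ι → K) := (Module.finrank_fintype_fun_eq_card K).symm
      _ = Module.finrank K (⊤ : Submodule K (ι → K)) := (finrank_top K (ι → K)).symm
      _ = (((s.image Φ : Finset (ι → K)) : Set (ι → K))).finrank K := by
          rw [Set.finrank, htop]
      _ ≤ (s.image Φ).card := finrank_span_finset_le_card _
      _ ≤ s.card := Finset.card_image_le

/-- Absorbs signs: `initialForms` takes leading minus trailing monomial, while f_7 is written the
other way round. -/
theorem MinimallyGenerates.of_neg {R : Type*} [CommRing R] {g g' : ι → R} {I : Ideal R}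
    (hg : MinimallyGenerates g I) (h : ∀ i, g' i = g i ∨ g' i = -g i) :
    MinimallyGenerates g' I := by
  have hspan : ∀ s : Set ι, Ideal.span (g' '' s) = Ideal.span (g '' s) := by
    intro s
    refine le_antisymm (Ideal.span_le.mpr ?_) (Ideal.span_le.mpr ?_) <;> rintro _ ⟨i, hi, rfl⟩
    · rcases h i with h | h <;> rw [h]
      · exact Ideal.subset_span ⟨i, hi, rfl⟩
      · exact (Ideal.neg_mem_iff _).mpr (Ideal.subset_span ⟨i, hi, rfl⟩)
    · rcases h i with h | h
      · rw [← h]; exact Ideal.subset_span ⟨i, hi, rfl⟩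
      · rw [← neg_neg (g i), ← h]
        exact (Ideal.neg_mem_iff _).mpr (Ideal.subset_span ⟨i, hi, rfl⟩)
  refine ⟨?_, fun i => ?_⟩
  · rw [← Set.image_univ, hspan, Set.image_univ]; exact hg.1
  · rw [hspan]
    rcases h i with h | h <;> rw [h]
    · exact hg.2 i
    · rw [Ideal.neg_mem_iff]; exact hg.2 i

end MinimalGenerators

/-! ### Depth zero at a prime of positive height -/

/-- A ring is not Cohen-Macaulay if it has an element that does not vanish locally at a prime ideal
of positive height, but is annihilated by a power of every element of that prime ideal. -/
theorem not_isCohenMacaulay_of_torsion {A : Type*} [CommRing A] {p q : Ideal A} [p.IsPrime]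
    [q.IsPrime] (hqp : q < p) {z : A} (hz : ∀ r ∈ p, ∃ k : ℕ, r ^ k * z = 0)
    (hz0 : ∀ s, s ∉ p → s * z ≠ 0) : ¬ IsCohenMacaulay A := by
  intro hA
  obtain ⟨rs, hreg, hlen⟩ := hA p
  have hz1 : algebraMap A (Localization.AtPrime p) z ≠ 0 := by
    intro h
    obtain ⟨s, hs⟩ := (IsLocalization.map_eq_zero_iff p.primeCompl _ z).mp h
    exact hz0 s s.2 hs
  -- An empty regular sequence would make the height of p zero. Otherwise its first member is a
  -- fraction with numerator in p, so one of its powers kills z although it is regular.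
  cases rs with
  | nil =>
    rw [IsLocalization.AtPrime.ringKrullDim_eq_height p] at hlen
    have h0 : p.height = 0 := by
      simpa using hlen.symm
    exact hqp.not_ge ((Ideal.height_eq_zero_iff.mp h0).2 ⟨‹q.IsPrime›, bot_le⟩ hqp.le)
  | cons x xs =>
    have hx : IsSMulRegular (Localization.AtPrime p) x :=
      ((RingTheory.Sequence.isRegular_cons_iff _ _ _).mp hreg).1
    have hxm : x ∈ IsLocalRing.maximalIdeal (Localization.AtPrime p) := by
      rw [IsLocalRing.mem_maximalIdeal, mem_nonunits_iff]
      intro hu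
      apply hreg.top_ne_smul
      rw [eq_comm, Ideal.ofList_cons, Ideal.span_singleton_eq_top.mpr hu, top_sup_eq,
        Submodule.top_smul]
    obtain ⟨⟨r, s⟩, hrs⟩ := IsLocalization.surj p.primeCompl x
    have hr : r ∈ p := by
      rw [← IsLocalization.AtPrime.to_map_mem_maximal_iff (Localization.AtPrime p) p, ← hrs]
      exact Ideal.mul_mem_right _ _ hxm
    obtain ⟨k, hk⟩ := hz r hr
    have hxk : x ^ k * algebraMap A (Localization.AtPrime p) z = 0 := by
      have hs : IsUnit (algebraMap A (Localization.AtPrime p) s ^ k) :=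
        (IsLocalization.map_units _ s).pow k
      rw [← hs.mul_right_eq_zero, ← mul_assoc, ← mul_pow, mul_comm _ x, hrs, ← map_pow, ← map_mul,
        hk, map_zero]
    exact hz1 ((hx.pow k) (by simpa using hxk))

/-! ### Standard bases of toric ideals consisting of binomials -/

section StandardBasis

variable {σ : Type*}

theorem NegDegRevLexLT.degree_le {rank : σ → ℕ} {α β : σ →₀ ℕ} (h : NegDegRevLexLT rank α β) :
    β.degree ≤ α.degree := by
  rcases h with h | h
  · exact h.le
  · exact h.1.ge

theorem NegDegRevLexLT.add_left {rank : σ → ℕ} {α β : σ →₀ ℕ} (h : NegDegRevLexLT rank α β)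
    (γ : σ →₀ ℕ) : NegDegRevLexLT rank (γ + α) (γ + β) := by
  rcases h with h | ⟨h, i, hi, hj⟩
  · left; simpa using h
  · refine Or.inr ⟨by simpa using h, i, by simpa using hi, fun j hij => by simpa using hj j hij⟩

theorem isStrictOrder_negDegRevLexLT {rank : σ → ℕ} (hrank : Function.Injective rank) :
    IsStrictOrder (σ →₀ ℕ) (NegDegRevLexLT rank) where
  irrefl α h := by
    rcases h with h | ⟨-, i, hi, -⟩
    · exact lt_irrefl _ h
    · exact lt_irrefl _ hi
  trans α β γ h₁ h₂ := by
    have hd := h₂.degree_le.trans h₁.degree_le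
    rcases hd.lt_or_eq with hlt | heq
    · exact Or.inl hlt
    have hβ : α.degree = β.degree := le_antisymm (heq ▸ h₂.degree_le) h₁.degree_le
    rcases h₁ with h₁ | ⟨-, i, hi, hi'⟩
    · exact absurd hβ h₁.ne'
    rcases h₂ with h₂ | ⟨-, j, hj, hj'⟩
    · exact absurd (heq.trans hβ) h₂.ne
    refine Or.inr ⟨heq.symm, ?_⟩
    rcases lt_trichotomy (rank i) (rank j) with hij | hij | hij
    · exact ⟨j, hi' j hij ▸ hj, fun k hk => (hi' k (hij.trans hk)).trans (hj' k hk)⟩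
    · obtain rfl := hrank hij
      exact ⟨i, hj.trans hi, fun k hk => (hi' k hk).trans (hj' k hk)⟩
    · exact ⟨i, hj' i hij ▸ hi, fun k hk => (hi' k hk).trans (hj' k (hij.trans hk))⟩

variable {K : Type*} [Field K] {ι : Type*} {n : σ → ℕ} {rank : σ → ℕ} {lm tl : ι → σ →₀ ℕ}

theorem monomial_sub_mem_of_le {J : Ideal (MvPolynomial σ K)} {α β γ : σ →₀ ℕ}
    (h : monomial α (1 : K) - monomial β 1 ∈ J) (hα : α ≤ γ) :
    monomial γ (1 : K) - monomial (γ - α + β) 1 ∈ J := by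
  have hm := J.mul_mem_left (monomial (γ - α) 1) h
  rwa [mul_sub, monomial_mul, monomial_mul, one_mul, tsub_add_cancel_of_le hα] at hm

theorem monomial_mem_of_le {J : Ideal (MvPolynomial σ K)} {α γ : σ →₀ ℕ}
    (h : monomial α (1 : K) ∈ J) (hα : α ≤ γ) : monomial γ (1 : K) ∈ J := by
  have hm := J.mul_mem_left (monomial (γ - α) 1) h
  rwa [monomial_mul, one_mul, tsub_add_cancel_of_le hα] at hm

/-- Every monomial can be rewritten, using the rules `lm i → tl i`, into a monomial to which no
rule applies. -/
theorem exists_irreducible [Finite σ] (hn : ∀ i, n i ≠ 0) (hrank : Function.Injective rank)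
    (hw : ∀ i, Finsupp.weight n (tl i) = Finsupp.weight n (lm i))
    (hlt : ∀ i, NegDegRevLexLT rank (tl i) (lm i)) {J : Ideal (MvPolynomial σ K)}
    (hJ : ∀ i, (tl i).degree = (lm i).degree → monomial (lm i) (1 : K) - monomial (tl i) 1 ∈ J)
    (hJ' : ∀ i, (lm i).degree < (tl i).degree → monomial (lm i) (1 : K) ∈ J) (α : σ →₀ ℕ) :
    ∃ s : σ →₀ ℕ, (∀ i, ¬ lm i ≤ s) ∧ Finsupp.weight n s = Finsupp.weight n α ∧
      (s = α ∨ NegDegRevLexLT rank s α) ∧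
      ((s.degree = α.degree ∧ monomial α (1 : K) - monomial s 1 ∈ J) ∨
        (α.degree < s.degree ∧ monomial α (1 : K) ∈ J)) := by
  have hso := isStrictOrder_negDegRevLexLT hrank
  -- The ordering is local, hence not well-founded on all monomials; within one weight it is,
  -- because positive weights leave finitely many monomials.
  have hfin : {β : σ →₀ ℕ | Finsupp.weight n β = Finsupp.weight n α}.Finite :=
    (Finsupp.finite_of_nat_weight_le n hn (Finsupp.weight n α)).subset fun β hβ => le_of_eq hβ
  refine (hfin.wellFoundedOn (r := NegDegRevLexLT rank)).induction
    (P := fun α => ∃ s : σ →₀ ℕ, (∀ i, ¬ lm i ≤ s) ∧ Finsupp.weight n s = Finsupp.weight n α ∧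
      (s = α ∨ NegDegRevLexLT rank s α) ∧
      ((s.degree = α.degree ∧ monomial α (1 : K) - monomial s 1 ∈ J) ∨
        (α.degree < s.degree ∧ monomial α (1 : K) ∈ J))) (Set.mem_ofPred.mpr rfl) ?_
  intro β hβ ih
  by_cases hirr : ∀ i, ¬ lm i ≤ β
  · exact ⟨β, hirr, rfl, Or.inl rfl, Or.inl ⟨rfl, by rw [sub_self]; exact zero_mem _⟩⟩
  push Not at hirr
  obtain ⟨i, hi⟩ := hirr
  have hwγ : Finsupp.weight n (β - lm i + tl i) = Finsupp.weight n β := by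
    rw [map_add, hw, ← map_add, tsub_add_cancel_of_le hi]
  have hγ : NegDegRevLexLT rank (β - lm i + tl i) β := by
    have := (hlt i).add_left (β - lm i)
    rwa [tsub_add_cancel_of_le hi] at this
  obtain ⟨s, hs, hsw, hsγ, hsJ⟩ := ih _ (hwγ.trans hβ) hγ
  refine ⟨s, hs, hsw.trans hwγ, Or.inr ?_, ?_⟩
  · rcases hsγ with rfl | h
    · exact hγ
    · exact hso.trans _ _ _ h hγ
  have hdγ : (β - lm i + tl i).degree + (lm i).degree = β.degree + (tl i).degree := by
    have := congrArg Finsupp.degree (tsub_add_cancel_of_le hi)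
    rw [map_add] at this ⊢
    omega
  -- Rewriting never lowers the degree. As soon as one step raises it, the monomial itself lies in
  -- J, not merely a difference.
  rcases (hlt i).degree_le.eq_or_lt with hd | hd
  · have hmem := monomial_sub_mem_of_le (hJ i hd.symm) hi
    rcases hsJ with ⟨h1, h2⟩ | ⟨h1, h2⟩
    · exact Or.inl ⟨by omega, by simpa using add_mem hmem h2⟩
    · exact Or.inr ⟨by omega, by simpa using add_mem hmem h2⟩
  · refine Or.inr ⟨?_, monomial_mem_of_le (hJ' i hd) hi⟩
    rcases hsJ with ⟨h1, -⟩ | ⟨h1, -⟩ <;> omega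

/-- Binomials in a toric ideal form a standard basis if distinct monomials that are not divisible
by any of their leading monomials have distinct weights. -/
theorem isStandardBasis_of_injOn [Finite σ] [Finite ι] (hn : ∀ i, n i ≠ 0)
    (hrank : Function.Injective rank)
    (hw : ∀ i, Finsupp.weight n (tl i) = Finsupp.weight n (lm i))
    (hlt : ∀ i, NegDegRevLexLT rank (tl i) (lm i))
    (hinj : ∀ α β : σ →₀ ℕ, (∀ i, ¬ lm i ≤ α) → (∀ i, ¬ lm i ≤ β) →
      Finsupp.weight n α = Finsupp.weight n β → α = β)
    {f : ι → MvPolynomial σ K}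
    (hf : ∀ i, f i = monomial (lm i) 1 - monomial (tl i) 1 ∨
      f i = -(monomial (lm i) 1 - monomial (tl i) 1)) :
    IsStandardBasis (NegDegRevLexLT rank) (Set.range f) (toricIdeal K n) := by
  classical
  have hso := isStrictOrder_negDegRevLexLT hrank
  have hmem : ∀ i, f i ∈ toricIdeal K n := fun i => by
    rcases hf i with h | h <;> rw [h]
    · exact monomial_sub_monomial_mem_toricIdeal.mpr (hw i).symm
    · exact (Ideal.neg_mem_iff _).mpr (monomial_sub_monomial_mem_toricIdeal.mpr (hw i).symm)
  have hne : ∀ i, tl i ≠ lm i := fun i h => hso.irrefl (lm i) (by simpa [h] using hlt i)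
  have hlead : ∀ i, IsLeadingExponent (NegDegRevLexLT rank) (f i) (lm i) := by
    intro i
    have hsupp : (f i).support = (monomial (lm i) (1 : K) - monomial (tl i) 1).support := by
      rcases hf i with h | h <;> rw [h]
      exact support_neg σ
    refine ⟨?_, fun γ hγ hγ' => ?_⟩
    · rw [hsupp, mem_support_iff, coeff_sub, coeff_monomial, coeff_monomial, if_pos rfl,
        if_neg (hne i), sub_zero]
      exact one_ne_zero
    · rw [hsupp, mem_support_iff, coeff_sub, coeff_monomial, coeff_monomial,
        if_neg hγ'.symm, zero_sub] at hγ
      by_cases h : tl i = γ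
      · exact h ▸ hlt i
      · rw [if_neg h, neg_zero] at hγ
        exact absurd rfl hγ
  refine ⟨Set.finite_range f, ?_, le_antisymm (Ideal.span_mono ?_) (Ideal.span_le.mpr ?_)⟩
  · rintro _ ⟨i, rfl⟩; exact hmem i
  · rintro p ⟨_, ⟨i, rfl⟩, m, hm⟩
    exact ⟨f i, hmem i, m, hm⟩
  rintro _ ⟨g, hg, m, ⟨hm, hmax⟩, rfl⟩
  -- If the leading exponent m were irreducible, cancellation in its weight would force another
  -- exponent m' of g. Its normal form can only be m, so m is at most m', against maximality. Only
  -- the ordering matters here, hence J = ⊤.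
  have hdiv : ∃ i, lm i ≤ m := by
    by_contra hirr
    push Not at hirr
    have hsum := sum_coeff_eq_zero_of_mem_toricIdeal hg (Finsupp.weight n m)
    obtain ⟨m', hm', hne'⟩ : ∃ m' ∈ g.support.filter
        (fun α => Finsupp.weight n α = Finsupp.weight n m), m' ≠ m := by
      by_contra hall
      push Not at hall
      rw [Finset.sum_eq_single m (fun b hb hb' => absurd (hall b hb) hb')
        (fun h => (h (by simpa using hm)).elim)] at hsum
      exact mem_support_iff.mp hm hsum
    rw [Finset.mem_filter] at hm'
    have hlt' := hmax m' hm'.1 hne'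
    obtain ⟨s, hs, hsw, hsm, -⟩ := exists_irreducible hn hrank hw hlt
      (J := (⊤ : Ideal (MvPolynomial σ K))) (fun _ _ => trivial) (fun _ _ => trivial) m'
    obtain rfl := hinj s m hs hirr (hsw.trans hm'.2)
    rcases hsm with h | h
    · exact hne' h.symm
    · exact hso.irrefl _ (hso.trans _ _ _ h hlt')
  obtain ⟨i, hi⟩ := hdiv
  exact monomial_mem_of_le (Ideal.subset_span ⟨f i, ⟨i, rfl⟩, lm i, hlead i, rfl⟩) hi

/-- The initial forms of such a standard basis generate the ideal of initial forms. -/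
theorem span_range_eq_initialFormIdeal_of_injOn [Finite σ] (hn : ∀ i, n i ≠ 0)
    (hrank : Function.Injective rank)
    (hw : ∀ i, Finsupp.weight n (tl i) = Finsupp.weight n (lm i))
    (hlt : ∀ i, NegDegRevLexLT rank (tl i) (lm i))
    (hinj : ∀ α β : σ →₀ ℕ, (∀ i, ¬ lm i ≤ α) → (∀ i, ¬ lm i ≤ β) →
      Finsupp.weight n α = Finsupp.weight n β → α = β) :
    Ideal.span (Set.range fun i => monomial (lm i) (1 : K) -
      if (tl i).degree = (lm i).degree then monomial (tl i) 1 else 0) =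
      initialFormIdeal (toricIdeal K n) := by
  set J := Ideal.span (Set.range fun i => monomial (lm i) (1 : K) -
      if (tl i).degree = (lm i).degree then monomial (tl i) 1 else 0) with hJdef
  refine le_antisymm (Ideal.span_le.mpr ?_) ?_
  · rintro _ ⟨i, rfl⟩
    dsimp only
    split_ifs with h
    · exact monomial_sub_monomial_mem_initialFormIdeal (hw i).symm h.symm
    · rw [sub_zero]
      exact monomial_mem_initialFormIdeal (hw i).symm
        (lt_of_le_of_ne (hlt i).degree_le (Ne.symm h))
  have hJ : ∀ i, (tl i).degree = (lm i).degree →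
      monomial (lm i) (1 : K) - monomial (tl i) 1 ∈ J := fun i h =>
    Ideal.subset_span ⟨i, by simp only [if_pos h]⟩
  have hJ' : ∀ i, (lm i).degree < (tl i).degree → monomial (lm i) (1 : K) ∈ J := fun i h =>
    Ideal.subset_span ⟨i, by simp only [if_neg h.ne', sub_zero]⟩
  -- Exponents of equal weight have one common normal form s; comparing degrees with s decides which
  -- memberships combine.
  refine initialFormIdeal_toricIdeal_le (fun α β hαβ hd => ?_) (fun α β hαβ hd => ?_) <;>
  obtain ⟨s, hs, hsw, -, hsJ⟩ := exists_irreducible hn hrank hw hlt hJ hJ' α <;>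
  obtain ⟨t, ht, htw, -, htJ⟩ := exists_irreducible hn hrank hw hlt hJ hJ' β <;>
  obtain rfl := hinj s t hs ht (hsw.trans (hαβ.trans htw.symm))
  · rcases hsJ with ⟨h1, h2⟩ | ⟨h1, h2⟩ <;> rcases htJ with ⟨h3, h4⟩ | ⟨h3, h4⟩
    · simpa using sub_mem h2 h4
    · omega
    · omega
    · exact sub_mem h2 h4
  · rcases hsJ with ⟨h1, h2⟩ | ⟨h1, h2⟩ <;> rcases htJ with ⟨h3, h4⟩ | ⟨h3, h4⟩
    · omega
    · omega
    · exact h2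
    · exact h2

end StandardBasis

/-! ### The arithmetic of the family of curves -/

/-- The weight of `x_1^p x_2^q x_3^r x_4^s`. -/
def wt (n : Fin 4 → ℕ) (p q r s : ℕ) : ℕ := p * n 0 + q * n 1 + r * n 2 + s * n 3

/-- The exponent of `x_1^p x_2^q x_3^r x_4^s`. -/
noncomputable def expo (p q r s : ℕ) : Fin 4 →₀ ℕ := Finsupp.equivFunOnFinite.symm ![p, q, r, s]

@[simp] theorem expo_zero (p q r s : ℕ) : expo p q r s 0 = p := rfl
@[simp] theorem expo_one (p q r s : ℕ) : expo p q r s 1 = q := rfl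
@[simp] theorem expo_two (p q r s : ℕ) : expo p q r s 2 = r := rfl
@[simp] theorem expo_three (p q r s : ℕ) : expo p q r s 3 = s := rfl

theorem expo_le_iff {p q r s : ℕ} {α : Fin 4 →₀ ℕ} :
    expo p q r s ≤ α ↔ p ≤ α 0 ∧ q ≤ α 1 ∧ r ≤ α 2 ∧ s ≤ α 3 := by
  rw [Finsupp.le_def]; simp [Fin.forall_fin_succ]

theorem expo_eta (α : Fin 4 →₀ ℕ) : expo (α 0) (α 1) (α 2) (α 3) = α := by
  ext i; fin_cases i <;> rfl

theorem weight_eq_wt (n : Fin 4 → ℕ) (α : Fin 4 →₀ ℕ) :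
    Finsupp.weight n α = wt n (α 0) (α 1) (α 2) (α 3) := by
  rw [Finsupp.weight_eq_sum]; simp [Fin.sum_univ_four, wt]

theorem degree_eq_sum_four (α : Fin 4 →₀ ℕ) : α.degree = α 0 + α 1 + α 2 + α 3 := by
  rw [Finsupp.degree_eq_sum, Fin.sum_univ_four]

theorem monomial_expo (K : Type*) [Field K] (p q r s : ℕ) :
    monomial (expo p q r s) (1 : K) = X 0 ^ p * X 1 ^ q * X 2 ^ r * X 3 ^ s := by
  rw [monomial_eq, Finsupp.prod_fintype _ _ (by simp)]
  simp [Fin.prod_univ_four]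

/-! ### Equal weights seen through the five generators -/

namespace HasToricGenerators

variable {K : Type*} [Field K] {n : Fin 4 → ℕ} {a : CurveExponents}

/-- A set of monomials closed under multiplication that contains both monomials of each of
`f_1, …, f_5` contains, with a monomial, all monomials of the same weight. -/
theorem transfer (h : HasToricGenerators K n a) (D : ℕ → ℕ → ℕ → ℕ → Prop)
    (hD : ∀ p q r s p' q' r' s', p ≤ p' → q ≤ q' → r ≤ r' → s ≤ s' → D p q r s → D p' q' r' s')
    (h1 : D a.a1 0 0 0 ∧ D 0 0 a.a13 a.a14) (h2 : D 0 a.a2 0 0 ∧ D a.a21 0 a.a23 0)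
    (h3 : D 0 0 a.a3 0 ∧ D 0 a.a32 0 a.a34) (h4 : D 0 0 0 a.a4 ∧ D a.a41 a.a42 0 0)
    (h5 : D a.a21 0 0 a.a34 ∧ D 0 a.a42 a.a13 0) {p q r s p' q' r' s' : ℕ}
    (hw : wt n p q r s = wt n p' q' r' s') (hpq : D p q r s) : D p' q' r' s' := by
  classical
  by_contra hn
  have hmem : monomial (expo p q r s) (1 : K) - monomial (expo p' q' r' s') 1 ∈
      toricIdeal K n := by
    rw [monomial_sub_monomial_mem_toricIdeal, weight_eq_wt, weight_eq_wt]; exact hw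
  rw [← h.minimallyGenerates.1] at hmem
  have h0 : coeff (expo p' q' r' s')
      (monomial (expo p q r s) (1 : K) - monomial (expo p' q' r' s') 1) = 0 := by
    -- The complement of a set closed under multiples is closed under division.
    refine coeff_eq_zero_of_mem_span (D := fun α => ¬ D (α 0) (α 1) (α 2) (α 3))
      (fun α β hαβ hβ => hαβ (hD _ _ _ _ _ _ _ _ ?_ ?_ ?_ ?_ hβ)) ?_ hmem (by simpa using hn)
    · simp
    · simp
    · simp
    · simp
    have key : ∀ {p q r s p' q' r' s' : ℕ}, D p q r s ∧ D p' q' r' s' → ∀ β : Fin 4 →₀ ℕ,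
        ¬ D (β 0) (β 1) (β 2) (β 3) →
        coeff β (monomial (expo p q r s) (1 : K) - monomial (expo p' q' r' s') 1) = 0 := by
      intro p q r s p' q' r' s' hDD β hβ
      rw [coeff_sub, coeff_monomial, coeff_monomial, if_neg, if_neg, sub_zero]
      · rintro rfl; exact hβ hDD.2
      · rintro rfl; exact hβ hDD.1
    rintro _ ⟨i, rfl⟩ β hβ
    have k1 := key h1 β hβ
    have k2 := key h2 β hβ
    have k3 := key h3 β hβ
    have k4 := key h4 β hβ
    have k5 := key h5 β hβ
    simp only [monomial_expo, pow_zero, one_mul, mul_one] at k1 k2 k3 k4 k5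
    fin_cases i
    · exact k1
    · exact k2
    · exact k3
    · exact k4
    · exact k5
  rw [coeff_sub, coeff_monomial, coeff_monomial, if_pos rfl, if_neg, zero_sub] at h0
  · exact one_ne_zero (neg_eq_zero.mp h0)
  · intro he
    have e0 := DFunLike.congr_fun he 0
    have e1 := DFunLike.congr_fun he 1
    have e2 := DFunLike.congr_fun he 2
    have e3 := DFunLike.congr_fun he 3
    simp only [expo_zero, expo_one, expo_two, expo_three] at e0 e1 e2 e3
    subst e0 e1 e2 e3
    exact hn hpq

theorem wt_f1 (h : HasToricGenerators K n a) : wt n a.a1 0 0 0 = wt n 0 0 a.a13 a.a14 := by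
  have hm : a.f1 K ∈ toricIdeal K n :=
    h.minimallyGenerates.1 ▸ Ideal.subset_span ⟨0, rfl⟩
  have := monomial_sub_monomial_mem_toricIdeal (K := K) (n := n) (α := expo a.a1 0 0 0)
    (β := expo 0 0 a.a13 a.a14)
  simp only [weight_eq_wt, monomial_expo, pow_zero, one_mul, mul_one] at this
  exact this.mp hm

theorem wt_f2 (h : HasToricGenerators K n a) : wt n 0 a.a2 0 0 = wt n a.a21 0 a.a23 0 := by
  have hm : a.f2 K ∈ toricIdeal K n :=
    h.minimallyGenerates.1 ▸ Ideal.subset_span ⟨1, rfl⟩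
  have := monomial_sub_monomial_mem_toricIdeal (K := K) (n := n) (α := expo 0 a.a2 0 0)
    (β := expo a.a21 0 a.a23 0)
  simp only [weight_eq_wt, monomial_expo, pow_zero, one_mul, mul_one] at this
  exact this.mp hm

theorem wt_f3 (h : HasToricGenerators K n a) : wt n 0 0 a.a3 0 = wt n 0 a.a32 0 a.a34 := by
  have hm : a.f3 K ∈ toricIdeal K n :=
    h.minimallyGenerates.1 ▸ Ideal.subset_span ⟨2, rfl⟩
  have := monomial_sub_monomial_mem_toricIdeal (K := K) (n := n) (α := expo 0 0 a.a3 0)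
    (β := expo 0 a.a32 0 a.a34)
  simp only [weight_eq_wt, monomial_expo, pow_zero, one_mul, mul_one] at this
  exact this.mp hm

theorem wt_f4 (h : HasToricGenerators K n a) : wt n 0 0 0 a.a4 = wt n a.a41 a.a42 0 0 := by
  have hm : a.f4 K ∈ toricIdeal K n :=
    h.minimallyGenerates.1 ▸ Ideal.subset_span ⟨3, rfl⟩
  have := monomial_sub_monomial_mem_toricIdeal (K := K) (n := n) (α := expo 0 0 0 a.a4)
    (β := expo a.a41 a.a42 0 0)
  simp only [weight_eq_wt, monomial_expo, pow_zero, one_mul, mul_one] at this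
  exact this.mp hm

theorem wt_f5 (h : HasToricGenerators K n a) :
    wt n a.a21 0 0 a.a34 = wt n 0 a.a42 a.a13 0 := by
  have hm : a.f5 K ∈ toricIdeal K n :=
    h.minimallyGenerates.1 ▸ Ideal.subset_span ⟨4, rfl⟩
  have := monomial_sub_monomial_mem_toricIdeal (K := K) (n := n) (α := expo a.a21 0 0 a.a34)
    (β := expo 0 a.a42 a.a13 0)
  simp only [weight_eq_wt, monomial_expo, pow_zero, one_mul, mul_one] at this
  exact this.mp hm

end HasToricGenerators

/-! ### Divisibility forced by equal weights -/

namespace HasToricGenerators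

variable {K : Type*} [Field K] {n : Fin 4 → ℕ} {a : CurveExponents}

/-- In `transfer`, D consists of the multiples of x_1^{a_1} and of every other variable. The
right-hand monomial lies in D unless it is 1. -/
theorem le_of_pure_one (h : HasToricGenerators K n a) {p q r s : ℕ}
    (hw : wt n p 0 0 0 = wt n 0 q r s) : a.a1 ≤ p ∨ (q = 0 ∧ r = 0 ∧ s = 0) := by
  obtain ⟨⟨_, _⟩, ⟨_, _⟩, ⟨_, _⟩, ⟨_, _⟩, ⟨_, _⟩, ⟨_, _⟩, ⟨_, _⟩, ⟨_, _⟩⟩ := h.admissible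
  by_contra hc
  have := h.transfer (fun p q r s => a.a1 ≤ p ∨ 0 < q ∨ 0 < r ∨ 0 < s)
    (by intros; omega) (by omega) (by omega)
    (by omega) (by omega) (by omega) hw.symm
    (by omega)
  omega

theorem le_of_pure_two (h : HasToricGenerators K n a) {p q r s : ℕ}
    (hw : wt n 0 q 0 0 = wt n p 0 r s) : a.a2 ≤ q ∨ (p = 0 ∧ r = 0 ∧ s = 0) := by
  obtain ⟨⟨_, _⟩, ⟨_, _⟩, ⟨_, _⟩, ⟨_, _⟩, ⟨_, _⟩, ⟨_, _⟩, ⟨_, _⟩, ⟨_, _⟩⟩ := h.admissible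
  by_contra hc
  have := h.transfer (fun p q r s => a.a2 ≤ q ∨ 0 < p ∨ 0 < r ∨ 0 < s)
    (by intros; omega) (by omega) (by omega)
    (by omega) (by omega) (by omega) hw.symm
    (by omega)
  omega

theorem le_of_pure_three (h : HasToricGenerators K n a) {p q r s : ℕ}
    (hw : wt n 0 0 r 0 = wt n p q 0 s) : a.a3 ≤ r ∨ (p = 0 ∧ q = 0 ∧ s = 0) := by
  obtain ⟨⟨_, _⟩, ⟨_, _⟩, ⟨_, _⟩, ⟨_, _⟩, ⟨_, _⟩, ⟨_, _⟩, ⟨_, _⟩, ⟨_, _⟩⟩ := h.admissible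
  by_contra hc
  have := h.transfer (fun p q r s => a.a3 ≤ r ∨ 0 < p ∨ 0 < q ∨ 0 < s)
    (by intros; omega) (by omega) (by omega)
    (by omega) (by omega) (by omega) hw.symm
    (by omega)
  omega

theorem le_of_pure_four (h : HasToricGenerators K n a) {p q r s : ℕ}
    (hw : wt n 0 0 0 s = wt n p q r 0) : a.a4 ≤ s ∨ (p = 0 ∧ q = 0 ∧ r = 0) := by
  obtain ⟨⟨_, _⟩, ⟨_, _⟩, ⟨_, _⟩, ⟨_, _⟩, ⟨_, _⟩, ⟨_, _⟩, ⟨_, _⟩, ⟨_, _⟩⟩ := h.admissible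
  by_contra hc
  have := h.transfer (fun p q r s => a.a4 ≤ s ∨ 0 < p ∨ 0 < q ∨ 0 < r)
    (by intros; omega) (by omega) (by omega)
    (by omega) (by omega) (by omega) hw.symm
    (by omega)
  omega

/-- The same device with two variables on each side: the listed divisors are the terms of f_1, …,
f_5 that involve only x_1 and x_4. -/
theorem dvd_of_one_four (h : HasToricGenerators K n a) {p q r s : ℕ}
    (hw : wt n p 0 0 s = wt n 0 q r 0) : (a.a1 ≤ p ∨ a.a4 ≤ s ∨ (a.a21 ≤ p ∧ a.a34 ≤ s)) ∨ (q = 0 ∧ r = 0) := by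
  obtain ⟨⟨_, _⟩, ⟨_, _⟩, ⟨_, _⟩, ⟨_, _⟩, ⟨_, _⟩, ⟨_, _⟩, ⟨_, _⟩, ⟨_, _⟩⟩ := h.admissible
  by_contra hc
  have := h.transfer (fun p q r s => (a.a1 ≤ p ∨ a.a4 ≤ s ∨ (a.a21 ≤ p ∧ a.a34 ≤ s)) ∨ 0 < q ∨ 0 < r)
    (by intros; omega) (by omega) (by omega)
    (by omega) (by omega) (by omega) hw.symm
    (by omega)
  omega

theorem dvd_of_two_three (h : HasToricGenerators K n a) {p q r s : ℕ}
    (hw : wt n 0 q r 0 = wt n p 0 0 s) : (a.a2 ≤ q ∨ a.a3 ≤ r ∨ (a.a42 ≤ q ∧ a.a13 ≤ r)) ∨ (p = 0 ∧ s = 0) := by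
  obtain ⟨⟨_, _⟩, ⟨_, _⟩, ⟨_, _⟩, ⟨_, _⟩, ⟨_, _⟩, ⟨_, _⟩, ⟨_, _⟩, ⟨_, _⟩⟩ := h.admissible
  by_contra hc
  have := h.transfer (fun p q r s => (a.a2 ≤ q ∨ a.a3 ≤ r ∨ (a.a42 ≤ q ∧ a.a13 ≤ r)) ∨ 0 < p ∨ 0 < s)
    (by intros; omega) (by omega) (by omega)
    (by omega) (by omega) (by omega) hw.symm
    (by omega)
  omega

theorem dvd_of_one_two (h : HasToricGenerators K n a) {p q r s : ℕ}
    (hw : wt n p q 0 0 = wt n 0 0 r s) : (a.a1 ≤ p ∨ a.a2 ≤ q ∨ (a.a41 ≤ p ∧ a.a42 ≤ q)) ∨ (r = 0 ∧ s = 0) := by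
  obtain ⟨⟨_, _⟩, ⟨_, _⟩, ⟨_, _⟩, ⟨_, _⟩, ⟨_, _⟩, ⟨_, _⟩, ⟨_, _⟩, ⟨_, _⟩⟩ := h.admissible
  by_contra hc
  have := h.transfer (fun p q r s => (a.a1 ≤ p ∨ a.a2 ≤ q ∨ (a.a41 ≤ p ∧ a.a42 ≤ q)) ∨ 0 < r ∨ 0 < s)
    (by intros; omega) (by omega) (by omega)
    (by omega) (by omega) (by omega) hw.symm
    (by omega)
  omega

theorem dvd_of_three_four (h : HasToricGenerators K n a) {p q r s : ℕ}
    (hw : wt n 0 0 r s = wt n p q 0 0) : (a.a3 ≤ r ∨ a.a4 ≤ s ∨ (a.a13 ≤ r ∧ a.a14 ≤ s)) ∨ (p = 0 ∧ q = 0) := by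
  obtain ⟨⟨_, _⟩, ⟨_, _⟩, ⟨_, _⟩, ⟨_, _⟩, ⟨_, _⟩, ⟨_, _⟩, ⟨_, _⟩, ⟨_, _⟩⟩ := h.admissible
  by_contra hc
  have := h.transfer (fun p q r s => (a.a3 ≤ r ∨ a.a4 ≤ s ∨ (a.a13 ≤ r ∧ a.a14 ≤ s)) ∨ 0 < p ∨ 0 < q)
    (by intros; omega) (by omega) (by omega)
    (by omega) (by omega) (by omega) hw.symm
    (by omega)
  omega

theorem dvd_of_two_four (h : HasToricGenerators K n a) {p q r s : ℕ}
    (hw : wt n 0 q 0 s = wt n p 0 r 0) : (a.a2 ≤ q ∨ a.a4 ≤ s ∨ (a.a32 ≤ q ∧ a.a34 ≤ s)) ∨ (p = 0 ∧ r = 0) := by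
  obtain ⟨⟨_, _⟩, ⟨_, _⟩, ⟨_, _⟩, ⟨_, _⟩, ⟨_, _⟩, ⟨_, _⟩, ⟨_, _⟩, ⟨_, _⟩⟩ := h.admissible
  by_contra hc
  have := h.transfer (fun p q r s => (a.a2 ≤ q ∨ a.a4 ≤ s ∨ (a.a32 ≤ q ∧ a.a34 ≤ s)) ∨ 0 < p ∨ 0 < r)
    (by intros; omega) (by omega) (by omega)
    (by omega) (by omega) (by omega) hw.symm
    (by omega)
  omega

/-- The exponents are tied together by four linear relations. -/
theorem relations (h : HasToricGenerators K n a) (hn : ∀ i, 0 < n i) :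
    a.a1 = a.a21 + a.a41 ∧ a.a2 = a.a32 + a.a42 ∧ a.a3 = a.a13 + a.a23 ∧
      a.a4 = a.a14 + a.a34 := by
  obtain ⟨⟨_, _⟩, ⟨_, _⟩, ⟨_, _⟩, ⟨_, _⟩, ⟨_, _⟩, ⟨_, _⟩, ⟨_, _⟩, ⟨_, _⟩⟩ := h.admissible
  have e1 := h.wt_f1
  have e2 := h.wt_f2
  have e3 := h.wt_f3
  have e4 := h.wt_f4
  have e5 := h.wt_f5
  simp only [wt, zero_mul, add_zero, zero_add] at e1 e2 e3 e4 e5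
  have n0 := hn 0
  have n1 := hn 1
  have n2 := hn 2
  have n3 := hn 3
  obtain ⟨b1, hb1⟩ := Nat.exists_eq_add_of_lt h.admissible.h21.2
  obtain ⟨b2, hb2⟩ := Nat.exists_eq_add_of_lt h.admissible.h42.2
  obtain ⟨b3, hb3⟩ := Nat.exists_eq_add_of_lt h.admissible.h13.2
  obtain ⟨b4, hb4⟩ := Nat.exists_eq_add_of_lt h.admissible.h34.2
  -- Combining f_5 with f_1 gives x_4^{a_14 + a_34} the weight of x_1^{a_1 - a_21} x_2^{a_42}.
  -- Combining f_5 with f_2, f_3, f_4 bounds a_3, a_2, a_1 likewise.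
  have r4 : a.a4 ≤ a.a14 + a.a34 := by
    have := h.le_of_pure_four (p := b1 + 1) (q := a.a42) (r := 0) (s := a.a14 + a.a34) (by
      simp only [wt]; rw [hb1] at e1; linarith)
    omega
  have r3 : a.a3 ≤ a.a13 + a.a23 := by
    have := h.le_of_pure_three (p := 0) (q := b2 + 1) (r := a.a13 + a.a23) (s := a.a34) (by
      simp only [wt]; rw [hb2] at e2; linarith)
    omega
  have r2 : a.a2 ≤ a.a32 + a.a42 := by
    have := h.le_of_pure_two (p := a.a21) (q := a.a32 + a.a42) (r := b3 + 1) (s := 0) (by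
      simp only [wt]; rw [hb3] at e3; linarith)
    omega
  have r1 : a.a1 ≤ a.a21 + a.a41 := by
    have := h.le_of_pure_one (p := a.a21 + a.a41) (q := 0) (r := a.a13) (s := b4 + 1) (by
      simp only [wt]; rw [hb4] at e4; linarith)
    omega
  -- The sum of the weight equations of f_1, …, f_4. As all n_i are positive, it forces equality in
  -- the four bounds.
  have hs : a.a1 * n 0 + a.a2 * n 1 + a.a3 * n 2 + a.a4 * n 3 =
      (a.a21 + a.a41) * n 0 + (a.a32 + a.a42) * n 1 + (a.a13 + a.a23) * n 2 +
        (a.a14 + a.a34) * n 3 := by linarith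
  have m1 := Nat.mul_le_mul_right (n 0) r1
  have m2 := Nat.mul_le_mul_right (n 1) r2
  have m3 := Nat.mul_le_mul_right (n 2) r3
  have m4 := Nat.mul_le_mul_right (n 3) r4
  exact ⟨Nat.eq_of_mul_eq_mul_right n0 (by omega), Nat.eq_of_mul_eq_mul_right n1 (by omega),
    Nat.eq_of_mul_eq_mul_right n2 (by omega), Nat.eq_of_mul_eq_mul_right n3 (by omega)⟩

end HasToricGenerators

/-! ### Standard monomials and their weights -/

/-- The monomial `x_1^p x_2^q x_3^r x_4^s` is not divisible by a leading monomial of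
`f_1, …, f_7`. -/
structure CurveExponents.Standard (a : CurveExponents) (p q r s : ℕ) : Prop where
  h1 : r < a.a13 ∨ s < a.a14
  h2 : q < a.a2
  h3 : q < a.a32 ∨ s < a.a34
  h4 : s < a.a4
  h5 : p < a.a21 ∨ s < a.a34
  h6 : r < a.a3 + a.a13
  h7 : q < a.a42 ∨ r < 2 * a.a13

namespace HasToricGenerators

variable {K : Type*} [Field K] {n : Fin 4 → ℕ} {a : CurveExponents}

theorem standard_one_three (h : HasToricGenerators K n a) {p q r s : ℕ}
    (hβ : a.Standard 0 q 0 s) (hw : wt n p 0 r 0 = wt n 0 q 0 s) : p = 0 ∧ r = 0 := by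
  obtain ⟨⟨_, _⟩, ⟨_, _⟩, ⟨_, _⟩, ⟨_, _⟩, ⟨_, _⟩, ⟨_, _⟩, ⟨_, _⟩, ⟨_, _⟩⟩ := h.admissible
  have := h.dvd_of_two_four hw.symm
  have := hβ.h2
  have := hβ.h3
  have := hβ.h4
  omega

theorem standard_one_two (h : HasToricGenerators K n a) (hn : ∀ i, 0 < n i) {p q r s : ℕ}
    (h14 : a.a14 ≤ a.a34) (hα : a.Standard p q 0 0) (hβ : a.Standard 0 0 r s)
    (hw : wt n p q 0 0 = wt n 0 0 r s) : p = 0 ∧ q = 0 := by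
  obtain ⟨⟨_, _⟩, ⟨_, _⟩, ⟨_, _⟩, ⟨_, _⟩, ⟨_, _⟩, ⟨_, _⟩, ⟨_, _⟩, ⟨_, _⟩⟩ := h.admissible
  obtain ⟨_, _, _, _⟩ := h.relations hn
  have e1 := h.wt_f1
  have e3 := h.wt_f3
  have e4 := h.wt_f4
  simp only [wt, zero_mul, add_zero, zero_add] at e1 e3 e4
  have := hα.h2
  have := hβ.h1
  have := hβ.h4
  have := hβ.h6
  rcases h.dvd_of_one_two hw with d1 | ⟨_, _⟩
  swap
  · have hz : p * n 0 + q * n 1 = 0 := by subst_vars; simpa [wt] using hw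
    have := hn 0
    have := hn 1
    rcases Nat.add_eq_zero_iff.mp hz with ⟨hz1, hz2⟩
    rw [Nat.mul_eq_zero] at hz1 hz2
    omega
  exfalso
  rcases h.dvd_of_three_four hw.symm with d2 | ⟨_, _⟩
  swap
  · omega
  obtain ⟨r', rfl⟩ := Nat.exists_eq_add_of_le (show a.a3 ≤ r by omega)
  obtain ⟨k, hk⟩ := Nat.exists_eq_add_of_le h14
  obtain ⟨t, ht⟩ := Nat.exists_eq_add_of_lt (show r' < a.a13 by omega)
  -- Trade x_1^{a_1} for x_3^{a_13} x_4^{a_14} and x_3^{a_3} for x_2^{a_32} x_4^{a_34}. After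
  -- cancelling, x_4 has exponent k + s < a_34, too small for any listed divisor.
  by_cases hp : a.a1 ≤ p
  · obtain ⟨p', rfl⟩ := Nat.exists_eq_add_of_le hp
    rw [hk] at e3
    rw [ht] at e1
    rcases le_total q a.a32 with hq | hq <;> obtain ⟨u, hu⟩ := Nat.exists_eq_add_of_le hq
    · rw [hu] at e3
      have := h.dvd_of_two_four (p := p') (q := u) (r := t + 1) (s := k + s) (by
        simp only [wt] at hw ⊢; linarith)
      omega
    · rw [hu] at hw
      have := h.le_of_pure_four (p := p') (q := u) (r := t + 1) (s := k + s) (by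
        simp only [wt] at hw ⊢; linarith)
      omega
  -- Now x_1^{a_41} x_2^{a_42} is traded for x_4^{a_4}; p' < a_21 excludes the mixed divisor.
  · obtain ⟨p', rfl⟩ := Nat.exists_eq_add_of_le (show a.a41 ≤ p by omega)
    obtain ⟨q', rfl⟩ := Nat.exists_eq_add_of_le (show a.a42 ≤ q by omega)
    obtain ⟨u, hu⟩ := Nat.exists_eq_add_of_lt (show q' < a.a32 by omega)
    obtain ⟨v, hv⟩ := Nat.exists_eq_add_of_lt (show s < a.a14 by omega)
    rw [hu] at e3
    rw [show a.a4 = s + v + 1 + a.a34 by omega] at e4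
    have := h.dvd_of_one_four (p := p') (q := u + 1) (r := r') (s := v + 1) (by
      simp only [wt] at hw ⊢; linarith)
    omega

theorem standard_one_four (h : HasToricGenerators K n a) (hn : ∀ i, 0 < n i) {p q r s : ℕ}
    (hα : a.Standard p 0 0 s) (hβ : a.Standard 0 q r 0)
    (hw : wt n p 0 0 s = wt n 0 q r 0) : p = 0 ∧ s = 0 := by
  obtain ⟨⟨_, _⟩, ⟨_, _⟩, ⟨_, _⟩, ⟨_, _⟩, ⟨_, _⟩, ⟨_, _⟩, ⟨_, _⟩, ⟨_, _⟩⟩ := h.admissible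
  obtain ⟨_, _, _, _⟩ := h.relations hn
  have e1 := h.wt_f1
  have e5 := h.wt_f5
  simp only [wt, zero_mul, add_zero, zero_add] at e1 e5
  have := hα.h4
  have := hα.h5
  have := hβ.h2
  have := hβ.h6
  have := hβ.h7
  rcases h.dvd_of_one_four hw with d1 | ⟨_, _⟩
  swap
  · have hz : p * n 0 + s * n 3 = 0 := by subst_vars; simpa [wt] using hw
    have := hn 0
    have := hn 3
    rcases Nat.add_eq_zero_iff.mp hz with ⟨hz1, hz2⟩
    rw [Nat.mul_eq_zero] at hz1 hz2
    omega
  exfalso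
  rcases h.dvd_of_two_three hw.symm with d2 | ⟨_, _⟩
  swap
  · omega
  obtain ⟨p', rfl⟩ := Nat.exists_eq_add_of_le (show a.a1 ≤ p by omega)
  obtain ⟨r', rfl⟩ := Nat.exists_eq_add_of_le (show a.a13 ≤ r by omega)
  have hw' : wt n p' 0 0 (s + a.a14) = wt n 0 q r' 0 := by
    simp only [wt] at hw ⊢; linarith
  have d3 := h.dvd_of_one_four hw'
  -- This is where f_6 and f_7 matter: they give r' < a_3, and q < a_42 or r' < a_13. With q < a_2
  -- and a_14 > 0, `d4` is already contradictory, so the remaining splits take place inside a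
  -- contradiction.
  have d4 := h.dvd_of_two_three hw'.symm
  obtain ⟨p'', rfl⟩ := Nat.exists_eq_add_of_le (show a.a21 ≤ p' by omega)
  obtain ⟨s', hs'⟩ := Nat.exists_eq_add_of_le (show a.a34 ≤ s + a.a14 by omega)
  rw [hs'] at hw'
  rcases le_total a.a42 q with hq | hq <;> obtain ⟨u, hu⟩ := Nat.exists_eq_add_of_le hq
  · obtain ⟨v, hv⟩ := Nat.exists_eq_add_of_lt (show r' < a.a13 by omega)
    rw [hv] at e5
    rw [hu] at hw'
    have := h.le_of_pure_two (p := p'') (q := u) (r := v + 1) (s := s') (by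
      simp only [wt] at hw' ⊢; linarith)
    omega
  · rw [hu] at e5
    rcases le_total a.a13 r' with hr | hr <;> obtain ⟨v, hv⟩ := Nat.exists_eq_add_of_le hr
    · rw [hv] at hw'
      have := h.le_of_pure_three (p := p'') (q := u) (r := v) (s := s') (by
        simp only [wt] at hw' ⊢; linarith)
      omega
    · rw [hv] at e5
      have hz : p'' * n 0 + s' * n 3 + u * n 1 + v * n 2 = 0 := by
        simp only [wt] at hw'; linarith
      have := hn 1
      have := hn 2
      simp only [Nat.add_eq_zero_iff, Nat.mul_eq_zero] at hz
      omega

theorem standard_one (h : HasToricGenerators K n a) {p q r s : ℕ} (hn : ∀ i, 0 < n i)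
    (h14 : a.a14 ≤ a.a34) (hβ : a.Standard 0 q r s)
    (hw : wt n p 0 0 0 = wt n 0 q r s) : p = 0 := by
  obtain ⟨⟨_, _⟩, ⟨_, _⟩, ⟨_, _⟩, ⟨_, _⟩, ⟨_, _⟩, ⟨_, _⟩, ⟨_, _⟩, ⟨_, _⟩⟩ := h.admissible
  obtain ⟨_, _, _, _⟩ := h.relations hn
  have e1 := h.wt_f1
  simp only [wt, zero_mul, add_zero, zero_add] at e1
  obtain ⟨_, _, _, _, _, _, _⟩ := hβ
  rcases h.le_of_pure_one hw with d1 | ⟨_, _, _⟩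
  swap
  · have hz : p * n 0 = 0 := by subst_vars; simpa [wt] using hw
    have := hn 0
    rw [Nat.mul_eq_zero] at hz
    omega
  exfalso
  obtain ⟨p', rfl⟩ := Nat.exists_eq_add_of_le d1
  -- x_1^{a_1} is traded for x_3^{a_13} x_4^{a_14}; what survives on each side depends on how r and
  -- s compare with a_13 and a_14.
  rcases le_total a.a13 r with hr | hr <;> obtain ⟨u, hu⟩ := Nat.exists_eq_add_of_le hr
  · rw [hu] at hw
    obtain ⟨v, hv⟩ := Nat.exists_eq_add_of_le (show s ≤ a.a14 by omega)
    rw [hv] at e1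
    have hw' : wt n p' 0 0 v = wt n 0 q u 0 := by simp only [wt] at hw ⊢; linarith
    have d3 := h.dvd_of_two_three hw'.symm
    omega
  · rw [hu] at e1
    rcases le_total a.a14 s with hs | hs <;> obtain ⟨v, hv⟩ := Nat.exists_eq_add_of_le hs
    · rw [hv] at hw
      have hw' : wt n 0 q 0 v = wt n p' 0 u 0 := by simp only [wt] at hw ⊢; linarith
      have d3 := h.dvd_of_two_four hw'
      by_cases hu0 : p' = 0 ∧ u = 0
      · have hz : q * n 1 + v * n 3 = 0 := by
          obtain ⟨rfl, rfl⟩ := hu0; simpa [wt] using hw'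
        have := hn 1
        have := hn 3
        simp only [Nat.add_eq_zero_iff, Nat.mul_eq_zero] at hz
        omega
      · omega
    · rw [hv] at e1
      have hw' : wt n 0 q 0 0 = wt n p' 0 u v := by simp only [wt] at hw ⊢; linarith
      have d3 := h.le_of_pure_two hw'
      omega

theorem standard_two (h : HasToricGenerators K n a) {p q r s : ℕ} (hn : ∀ i, 0 < n i)
    (hα : a.Standard 0 q 0 0) (hw : wt n 0 q 0 0 = wt n p 0 r s) : q = 0 := by
  have := hα.h2
  rcases h.le_of_pure_two hw with d1 | ⟨rfl, rfl, rfl⟩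
  · omega
  · have hz : q * n 1 = 0 := by simpa [wt] using hw
    have := hn 1
    rw [Nat.mul_eq_zero] at hz
    omega

theorem standard_four (h : HasToricGenerators K n a) {p q r s : ℕ} (hn : ∀ i, 0 < n i)
    (hα : a.Standard 0 0 0 s) (hw : wt n 0 0 0 s = wt n p q r 0) : s = 0 := by
  have := hα.h4
  rcases h.le_of_pure_four hw with d1 | ⟨rfl, rfl, rfl⟩
  · omega
  · have hz : s * n 3 = 0 := by simpa [wt] using hw
    have := hn 3
    rw [Nat.mul_eq_zero] at hz
    omega

theorem standard_three (h : HasToricGenerators K n a) {p q r s : ℕ} (hn : ∀ i, 0 < n i)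
    (h14 : a.a14 ≤ a.a34) (hα : a.Standard 0 0 r 0) (hβ : a.Standard p q 0 s)
    (hw : wt n 0 0 r 0 = wt n p q 0 s) : r = 0 := by
  obtain ⟨⟨_, _⟩, ⟨_, _⟩, ⟨_, _⟩, ⟨_, _⟩, ⟨_, _⟩, ⟨_, _⟩, ⟨_, _⟩, ⟨_, _⟩⟩ := h.admissible
  obtain ⟨_, _, _, _⟩ := h.relations hn
  have e1 := h.wt_f1
  have e3 := h.wt_f3
  simp only [wt, zero_mul, add_zero, zero_add] at e1 e3
  obtain ⟨_, _, _, _, _, _, _⟩ := hβ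
  have := hα.h6
  rcases h.le_of_pure_three hw with d1 | ⟨_, _, _⟩
  swap
  · have hz : r * n 2 = 0 := by subst_vars; simpa [wt] using hw
    have := hn 2
    rw [Nat.mul_eq_zero] at hz
    omega
  exfalso
  obtain ⟨r', rfl⟩ := Nat.exists_eq_add_of_le d1
  -- x_3^{a_3} is traded for x_2^{a_32} x_4^{a_34}, and the outcome depends on which of these powers
  -- is absorbed by x_2^q x_4^s.
  rcases le_or_gt a.a32 q with hq | hq
  · obtain ⟨u, rfl⟩ := Nat.exists_eq_add_of_le hq
    obtain ⟨v, hv⟩ := Nat.exists_eq_add_of_lt (show s < a.a34 by omega)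
    rw [hv] at e3
    have d3 := h.dvd_of_three_four (p := p) (q := u) (r := r') (s := v + 1) (by
      simp only [wt] at hw ⊢; linarith)
    have hz := hn 3
    by_cases hu0 : p = 0 ∧ u = 0
    · obtain ⟨rfl, rfl⟩ := hu0
      have hz' : r' * n 2 + (v + 1) * n 3 = 0 := by simp only [wt] at hw; linarith
      simp only [Nat.add_eq_zero_iff, Nat.mul_eq_zero] at hz'
      omega
    · omega
  · obtain ⟨u, hu⟩ := Nat.exists_eq_add_of_lt hq
    rw [hu] at e3
    rcases le_or_gt a.a34 s with hs | hs
    · obtain ⟨v, rfl⟩ := Nat.exists_eq_add_of_le hs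
      have d3 := h.dvd_of_one_four (p := p) (q := u + 1) (r := r') (s := v) (by
        simp only [wt] at hw ⊢; linarith)
      omega
    · obtain ⟨v, hv⟩ := Nat.exists_eq_add_of_lt hs
      rw [hv] at e3
      -- Neither power is absorbed, so x_1^p alone balances the other three variables; this forces a
      -- second trade, through f_1.
      have d3 := h.le_of_pure_one (p := p) (q := u + 1) (r := r') (s := v + 1) (by
        simp only [wt] at hw ⊢; linarith)
      obtain ⟨p', rfl⟩ := Nat.exists_eq_add_of_le (show a.a1 ≤ p by omega)
      obtain ⟨t, ht⟩ := Nat.exists_eq_add_of_lt (show r' < a.a13 by omega)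
      rw [ht] at e1
      rcases le_total (v + 1) a.a14 with hv' | hv' <;>
        obtain ⟨x, hx⟩ := Nat.exists_eq_add_of_le hv'
      · rw [hx] at e1
        have d4 := h.le_of_pure_two (p := p') (q := u + 1) (r := t + 1) (s := x) (by
          simp only [wt] at hw ⊢; linarith)
        omega
      · rw [add_assoc _ v 1, hx] at e3
        have d4 := h.dvd_of_two_four (p := p') (q := u + 1) (r := t + 1) (s := x) (by
          simp only [wt] at hw ⊢; linarith)
        omega

end HasToricGenerators

theorem CurveExponents.Standard.mono {a : CurveExponents} {p q r s p' q' r' s' : ℕ}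
    (h : a.Standard p' q' r' s') (hp : p ≤ p') (hq : q ≤ q') (hr : r ≤ r') (hs : s ≤ s') :
    a.Standard p q r s := by
  obtain ⟨_, _, _, _, _, _, _⟩ := h
  constructor <;> omega

theorem wt_eq_zero_iff {n : Fin 4 → ℕ} (hn : ∀ i, 0 < n i) {p q r s : ℕ} :
    wt n p q r s = 0 ↔ p = 0 ∧ q = 0 ∧ r = 0 ∧ s = 0 := by
  have := hn 0
  have := hn 1
  have := hn 2
  have := hn 3
  simp only [wt, Nat.add_eq_zero_iff, Nat.mul_eq_zero]
  omega

namespace HasToricGenerators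

variable {K : Type*} [Field K] {n : Fin 4 → ℕ} {a : CurveExponents}

/-- Each variable occurs on at most one side, which leaves sixteen distributions; exchanging the two
sides reduces them to the `standard_*` lemmas. -/
theorem wt_eq_zero_of_standard_of_coprime (h : HasToricGenerators K n a) (hn : ∀ i, 0 < n i)
    (h14 : a.a14 ≤ a.a34) {p q r s p' q' r' s' : ℕ} (hα : a.Standard p q r s)
    (hβ : a.Standard p' q' r' s') (hw : wt n p q r s = wt n p' q' r' s')
    (hp : p = 0 ∨ p' = 0) (hq : q = 0 ∨ q' = 0) (hr : r = 0 ∨ r' = 0) (hs : s = 0 ∨ s' = 0) :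
    wt n p q r s = 0 := by
  have hz : ∀ {p q r s : ℕ}, p = 0 ∧ q = 0 ∧ r = 0 ∧ s = 0 → wt n p q r s = 0 :=
    (wt_eq_zero_iff hn).mpr
  rcases hp with rfl | rfl <;> rcases hq with rfl | rfl <;> rcases hr with rfl | rfl <;>
    rcases hs with rfl | rfl
  · exact hz ⟨rfl, rfl, rfl, rfl⟩
  · exact hz ⟨rfl, rfl, rfl, h.standard_four hn hα hw⟩
  · exact hz ⟨rfl, rfl, h.standard_three hn h14 hα hβ hw, rfl⟩
  · have := h.standard_one_two hn h14 hβ hα hw.symm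
    exact hw.trans (hz ⟨this.1, this.2, rfl, rfl⟩)
  · exact hz ⟨rfl, h.standard_two hn hα hw, rfl, rfl⟩
  · have := h.standard_one_three hα hw.symm
    exact hw.trans (hz ⟨this.1, rfl, this.2, rfl⟩)
  · have := h.standard_one_four hn hβ hα hw.symm
    exact hw.trans (hz ⟨this.1, rfl, rfl, this.2⟩)
  · exact hw.trans (hz ⟨h.standard_one hn h14 hα hw.symm, rfl, rfl, rfl⟩)
  · exact hz ⟨h.standard_one hn h14 hβ hw, rfl, rfl, rfl⟩
  · have := h.standard_one_four hn hα hβ hw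
    exact hz ⟨this.1, rfl, rfl, this.2⟩
  · have := h.standard_one_three hβ hw
    exact hz ⟨this.1, rfl, this.2, rfl⟩
  · exact hw.trans (hz ⟨rfl, h.standard_two hn hβ hw.symm, rfl, rfl⟩)
  · have := h.standard_one_two hn h14 hα hβ hw
    exact hz ⟨this.1, this.2, rfl, rfl⟩
  · exact hw.trans (hz ⟨rfl, rfl, h.standard_three hn h14 hβ hα hw.symm, rfl⟩)
  · exact hw.trans (hz ⟨rfl, rfl, rfl, h.standard_four hn hβ hw.symm⟩)
  · exact hw.trans (hz ⟨rfl, rfl, rfl, rfl⟩)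

/-- Distinct standard monomials have distinct weights. -/
theorem eq_of_standard (h : HasToricGenerators K n a) (hn : ∀ i, 0 < n i)
    (h14 : a.a14 ≤ a.a34) {p q r s p' q' r' s' : ℕ} (hα : a.Standard p q r s)
    (hβ : a.Standard p' q' r' s') (hw : wt n p q r s = wt n p' q' r' s') :
    p = p' ∧ q = q' ∧ r = r' ∧ s = s' := by
  -- Divisors of standard monomials are standard, so the greatest common divisor can be cancelled.
  have key : ∀ x y : ℕ, ∃ m x' y', x = m + x' ∧ y = m + y' ∧ (x' = 0 ∨ y' = 0) := fun x y =>
    ⟨min x y, x - min x y, y - min x y, by omega, by omega, by omega⟩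
  obtain ⟨mp, x0, y0, rfl, rfl, c0⟩ := key p p'
  obtain ⟨mq, x1, y1, rfl, rfl, c1⟩ := key q q'
  obtain ⟨mr, x2, y2, rfl, rfl, c2⟩ := key r r'
  obtain ⟨ms, x3, y3, rfl, rfl, c3⟩ := key s s'
  have hw' : wt n x0 x1 x2 x3 = wt n y0 y1 y2 y3 := by simp only [wt] at hw ⊢; linarith
  have hx := h.wt_eq_zero_of_standard_of_coprime hn h14
    (hα.mono (by omega) (by omega) (by omega) (by omega))
    (hβ.mono (by omega) (by omega) (by omega) (by omega)) hw' c0 c1 c2 c3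
  have hy := hw' ▸ hx
  rw [wt_eq_zero_iff hn] at hx hy
  omega

end HasToricGenerators

/-! ### Leading and trailing monomials of the seven binomials -/

namespace CurveExponents

/-- The exponents of the leading monomials of `f_1, …, f_7`. -/
noncomputable def lead (a : CurveExponents) : Fin 7 → Fin 4 →₀ ℕ :=
  ![expo 0 0 a.a13 a.a14, expo 0 a.a2 0 0, expo 0 a.a32 0 a.a34, expo 0 0 0 a.a4,
    expo a.a21 0 0 a.a34, expo 0 0 (a.a3 + a.a13) 0, expo 0 a.a42 (2 * a.a13) 0]

/-- The exponents of the other monomials of `f_1, …, f_7`. -/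
noncomputable def tail (a : CurveExponents) : Fin 7 → Fin 4 →₀ ℕ :=
  ![expo a.a1 0 0 0, expo a.a21 0 a.a23 0, expo 0 0 a.a3 0, expo a.a41 a.a42 0 0,
    expo 0 a.a42 a.a13 0, expo a.a1 a.a32 0 (a.a34 - a.a14),
    expo (a.a1 + a.a21) 0 0 (a.a34 - a.a14)]

theorem standard_iff {a : CurveExponents} {α : Fin 4 →₀ ℕ} :
    (∀ i, ¬ a.lead i ≤ α) ↔ a.Standard (α 0) (α 1) (α 2) (α 3) := by
  simp only [Fin.forall_fin_succ, lead, IsEmpty.forall_iff, and_true]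
  simp [expo_le_iff]
  constructor
  · rintro ⟨_, _, _, _, _, _, _⟩
    constructor <;> omega
  · rintro ⟨_, _, _, _, _, _, _⟩
    omega

/-- The initial forms of `f_1, …, f_7`, up to sign. -/
noncomputable def initialForms (K : Type*) [Field K] (a : CurveExponents) (i : Fin 7) :
    MvPolynomial (Fin 4) K :=
  monomial (a.lead i) (1 : K) -
    if (a.tail i).degree = (a.lead i).degree then monomial (a.tail i) 1 else 0

end CurveExponents

/-- x_1 and then x_3 are the smallest variables, so in equal degree they are compared first; this
settles every tie needed. -/
theorem negDegRevLexLT_of {α β : Fin 4 →₀ ℕ}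
    (h : β 0 + β 1 + β 2 + β 3 < α 0 + α 1 + α 2 + α 3 ∨
      (α 0 + α 1 + α 2 + α 3 = β 0 + β 1 + β 2 + β 3 ∧
        (β 0 < α 0 ∨ α 0 = β 0 ∧ β 2 < α 2))) :
    NegDegRevLexLT ![3, 1, 2, 0] α β := by
  rw [NegDegRevLexLT, degree_eq_sum_four, degree_eq_sum_four]
  refine h.imp_right fun ⟨hd, h⟩ => ⟨hd, ?_⟩
  rcases h with h | ⟨h0, h⟩
  · exact ⟨0, h, fun j hj => absurd hj (by fin_cases j <;> simp)⟩
  · refine ⟨2, h, fun j hj => ?_⟩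
    fin_cases j <;> simp_all

namespace HasToricGenerators

variable {K : Type*} [Field K] {n : Fin 4 → ℕ} {a : CurveExponents}

theorem weight_tail (h : HasToricGenerators K n a) (h14 : a.a14 ≤ a.a34)
    (i : Fin 7) : Finsupp.weight n (a.tail i) = Finsupp.weight n (a.lead i) := by
  have e1 := h.wt_f1
  have e2 := h.wt_f2
  have e3 := h.wt_f3
  have e4 := h.wt_f4
  have e5 := h.wt_f5
  obtain ⟨k, hk⟩ := Nat.exists_eq_add_of_le h14
  rw [weight_eq_wt, weight_eq_wt]
  fin_cases i <;> simp [CurveExponents.tail, CurveExponents.lead]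
  · exact e1
  · exact e2.symm
  · exact e3
  · exact e4.symm
  · exact e5.symm
  -- f_6 = x_3^{a_13} f_3 - x_2^{a_32} x_4^{a_34 - a_14} f_1, and below f_7 = x_3^{a_13} f_5 +
  -- x_1^{a_21} x_4^{a_34 - a_14} f_1.
  · rw [hk] at e3 ⊢
    rw [Nat.add_sub_cancel_left]
    simp only [wt] at *; linarith
  · rw [hk] at e5 ⊢
    rw [Nat.add_sub_cancel_left]
    simp only [wt] at *; linarith

/-- n_1 is the smallest weight, so a power of x_1 has larger degree than a monomial of the same
weight in larger variables. -/
theorem lt_one (h : HasToricGenerators K n a) (hmono : StrictMono n) :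
    a.a13 + a.a14 < a.a1 := by
  have e1 := h.wt_f1
  have h13 := h.admissible.h13.1
  have h14 := h.admissible.h14.1
  have n2 : n 0 < n 2 := hmono (by decide)
  have n3 : n 0 < n 3 := hmono (by decide)
  simp only [wt] at e1
  by_contra! hc
  nlinarith [Nat.mul_lt_mul_of_pos_left n2 h13, Nat.mul_lt_mul_of_pos_left n3 h14,
    Nat.mul_le_mul_right (n 0) hc]

theorem lt_four (h : HasToricGenerators K n a) (hmono : StrictMono n) :
    a.a4 < a.a41 + a.a42 := by
  have e4 := h.wt_f4
  have h41 := h.admissible.h41.1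
  have h42 := h.admissible.h42.1
  have n0 : n 0 < n 3 := hmono (by decide)
  have n1 : n 1 < n 3 := hmono (by decide)
  simp only [wt] at e4
  by_contra! hc
  nlinarith [Nat.mul_lt_mul_of_pos_left n0 h41, Nat.mul_lt_mul_of_pos_left n1 h42,
    Nat.mul_le_mul_right (n 3) hc]

/-- By the exponent relations, the degree gap of f_7 (tail minus lead) is the sum of those of f_2
and f_6. Hence f_7 is homogeneous exactly when both of these are. -/
theorem tail_lt_lead (h : HasToricGenerators K n a) (hn : ∀ i, 0 < n i) (hmono : StrictMono n)
    (h5 : a.a21 + a.a34 < a.a42 + a.a13) (h2 : a.a2 ≤ a.a21 + a.a23)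
    (h3 : a.a32 + a.a34 ≤ a.a3) (h6 : a.a3 + a.a13 ≤ a.a1 + a.a32 + (a.a34 - a.a14))
    (i : Fin 7) : NegDegRevLexLT ![3, 1, 2, 0] (a.tail i) (a.lead i) := by
  obtain ⟨⟨_, _⟩, ⟨_, _⟩, ⟨_, _⟩, ⟨_, _⟩, ⟨_, _⟩, ⟨_, _⟩, ⟨_, _⟩, ⟨_, _⟩⟩ := h.admissible
  obtain ⟨_, _, _, _⟩ := h.relations hn
  have := h.lt_one hmono
  have := h.lt_four hmono
  apply negDegRevLexLT_of
  fin_cases i <;> simp [CurveExponents.tail, CurveExponents.lead] <;> omega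

theorem eq_of_irreducible (h : HasToricGenerators K n a) (hn : ∀ i, 0 < n i)
    (h14 : a.a14 ≤ a.a34) (α β : Fin 4 →₀ ℕ) (hα : ∀ i, ¬ a.lead i ≤ α)
    (hβ : ∀ i, ¬ a.lead i ≤ β) (hw : Finsupp.weight n α = Finsupp.weight n β) : α = β := by
  rw [CurveExponents.standard_iff] at hα hβ
  rw [weight_eq_wt, weight_eq_wt] at hw
  obtain ⟨e0, e1, e2, e3⟩ := h.eq_of_standard hn h14 hα hβ hw
  rw [← expo_eta α, ← expo_eta β, e0, e1, e2, e3]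

theorem span_initialForms (h : HasToricGenerators K n a) (hn : ∀ i, 0 < n i)
    (hmono : StrictMono n) (h5 : a.a21 + a.a34 < a.a42 + a.a13) (h14 : a.a14 ≤ a.a34)
    (h2 : a.a2 ≤ a.a21 + a.a23) (h3 : a.a32 + a.a34 ≤ a.a3)
    (h6 : a.a3 + a.a13 ≤ a.a1 + a.a32 + (a.a34 - a.a14)) :
    Ideal.span (Set.range (a.initialForms K)) = initialFormIdeal (toricIdeal K n) :=
  span_range_eq_initialFormIdeal_of_injOn (fun i => (hn i).ne') (rank := ![3, 1, 2, 0])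
    (by decide) (h.weight_tail h14) (h.tail_lt_lead hn hmono h5 h2 h3 h6)
    (h.eq_of_irreducible hn h14)

end HasToricGenerators

/-- The degree gap of f_3 is the sum of those of f_2 and f_5, and the latter is positive. So f_3 is
never homogeneous. -/
theorem HasToricGenerators.lt_three {K : Type*} [Field K] {n : Fin 4 → ℕ} {a : CurveExponents}
    (h : HasToricGenerators K n a) (hn : ∀ i, 0 < n i)
    (h5 : a.a21 + a.a34 < a.a42 + a.a13) (h2 : a.a2 ≤ a.a21 + a.a23) :
    a.a32 + a.a34 < a.a3 := by
  have := h.relations hn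
  omega

/-- A homogeneous f_7 cannot contain a pure power of x_1, again because n_1 is the smallest weight.
Such a term would keep the x_1-axis off the tangent cone. -/
theorem HasToricGenerators.not_pure_f7 {K : Type*} [Field K] {n : Fin 4 → ℕ} {a : CurveExponents}
    (h : HasToricGenerators K n a) (hmono : StrictMono n) (h14 : a.a14 ≤ a.a34)
    (hd : a.a1 + a.a21 + (a.a34 - a.a14) = a.a42 + 2 * a.a13) : a.a14 < a.a34 := by
  refine lt_of_le_of_ne h14 fun he => ?_
  have e1 := h.wt_f1
  have e5 := h.wt_f5
  have h42 := h.admissible.h42.1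
  have h13 := h.admissible.h13.1
  have n1 : n 0 < n 1 := hmono (by decide)
  have n2 : n 0 < n 2 := hmono (by decide)
  simp only [wt] at e1 e5
  rw [← he, Nat.sub_self, add_zero] at hd
  rw [← he] at e5
  have hd' := congrArg (· * n 0) hd
  beta_reduce at hd'
  nlinarith [Nat.mul_lt_mul_of_pos_left n1 h42, Nat.mul_lt_mul_of_pos_left n2 h13]

/-! ### Shape and irredundancy of the initial forms -/

namespace CurveExponents

variable {K : Type*} [Field K] {a : CurveExponents}

theorem initialForms_of_lt {i : Fin 7} (h : (a.lead i).degree < (a.tail i).degree) :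
    a.initialForms K i = monomial (a.lead i) 1 := by
  rw [initialForms, if_neg h.ne', sub_zero]

theorem initialForms_of_eq {i : Fin 7} (h : (a.tail i).degree = (a.lead i).degree) :
    a.initialForms K i = monomial (a.lead i) 1 - monomial (a.tail i) 1 := by
  rw [initialForms, if_pos h]

theorem coeff_initialForms_eq_zero {i : Fin 7} {β : Fin 4 →₀ ℕ} (h1 : a.lead i ≠ β)
    (h2 : (a.tail i).degree = (a.lead i).degree → a.tail i ≠ β) :
    coeff β (a.initialForms K i) = 0 := by
  classical
  rw [initialForms, coeff_sub, coeff_monomial, if_neg h1, zero_sub, neg_eq_zero]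
  split_ifs with h
  · rw [coeff_monomial, if_neg (h2 h)]
  · exact coeff_zero _

theorem initialForms_zero (h : a.a13 + a.a14 < a.a1) :
    a.initialForms K 0 = X 2 ^ a.a13 * X 3 ^ a.a14 := by
  rw [initialForms_of_lt (by simpa [lead, tail, degree_eq_sum_four] using h)]
  simp [lead, monomial_expo]

theorem initialForms_one (h : a.a2 < a.a21 + a.a23) : a.initialForms K 1 = X 1 ^ a.a2 := by
  rw [initialForms_of_lt (by simpa [lead, tail, degree_eq_sum_four] using h)]
  simp [lead, monomial_expo]

theorem initialForms_one' (h : a.a2 = a.a21 + a.a23) :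
    a.initialForms K 1 = X 1 ^ a.a2 - X 0 ^ a.a21 * X 2 ^ a.a23 := by
  rw [initialForms_of_eq (by simpa [lead, tail, degree_eq_sum_four] using h.symm)]
  simp [lead, tail, monomial_expo]

theorem initialForms_two (h : a.a32 + a.a34 < a.a3) :
    a.initialForms K 2 = X 1 ^ a.a32 * X 3 ^ a.a34 := by
  rw [initialForms_of_lt (by simpa [lead, tail, degree_eq_sum_four] using h)]
  simp [lead, monomial_expo]

theorem initialForms_three (h : a.a4 < a.a41 + a.a42) : a.initialForms K 3 = X 3 ^ a.a4 := by
  rw [initialForms_of_lt (by simpa [lead, tail, degree_eq_sum_four] using h)]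
  simp [lead, monomial_expo]

theorem initialForms_four (h : a.a21 + a.a34 < a.a42 + a.a13) :
    a.initialForms K 4 = X 0 ^ a.a21 * X 3 ^ a.a34 := by
  rw [initialForms_of_lt (by simpa [lead, tail, degree_eq_sum_four] using h)]
  simp [lead, monomial_expo]

theorem initialForms_five (h : a.a3 + a.a13 < a.a1 + a.a32 + (a.a34 - a.a14)) :
    a.initialForms K 5 = X 2 ^ (a.a3 + a.a13) := by
  rw [initialForms_of_lt (by simpa [lead, tail, degree_eq_sum_four] using h)]
  simp [lead, monomial_expo]

theorem initialForms_five' (h : a.a3 + a.a13 = a.a1 + a.a32 + (a.a34 - a.a14)) :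
    a.initialForms K 5 =
      X 2 ^ (a.a3 + a.a13) - X 0 ^ a.a1 * X 1 ^ a.a32 * X 3 ^ (a.a34 - a.a14) := by
  rw [initialForms_of_eq (by simpa [lead, tail, degree_eq_sum_four] using h.symm)]
  simp [lead, tail, monomial_expo]

theorem initialForms_six (h : a.a42 + 2 * a.a13 < a.a1 + a.a21 + (a.a34 - a.a14)) :
    a.initialForms K 6 = X 1 ^ a.a42 * X 2 ^ (2 * a.a13) := by
  rw [initialForms_of_lt (by simpa [lead, tail, degree_eq_sum_four] using h)]
  simp [lead, monomial_expo]

theorem initialForms_six' (h : a.a42 + 2 * a.a13 = a.a1 + a.a21 + (a.a34 - a.a14)) :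
    a.initialForms K 6 =
      X 1 ^ a.a42 * X 2 ^ (2 * a.a13) - X 0 ^ (a.a1 + a.a21) * X 3 ^ (a.a34 - a.a14) := by
  rw [initialForms_of_eq (by simpa [lead, tail, degree_eq_sum_four] using h.symm)]
  simp [lead, tail, monomial_expo]

theorem not_lead_le_lead (ha : a.Admissible) (i j : Fin 7) (hij : j ≠ i) :
    ¬ a.lead j ≤ a.lead i := by
  obtain ⟨⟨_, _⟩, ⟨_, _⟩, ⟨_, _⟩, ⟨_, _⟩, ⟨_, _⟩, ⟨_, _⟩, ⟨_, _⟩, ⟨_, _⟩⟩ := ha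
  fin_cases i <;> fin_cases j <;> first
    | exact absurd rfl hij
    | (simp [lead, expo_le_iff]; omega)

/-- The tails that can tie are those of f_2, f_6, f_7. All contain x_1, and the only leading
monomial with x_1 is x_1^{a_21} x_4^{a_34}: it lacks the x_3 of the first tail and has too small a
power of x_1 for the others. -/
theorem not_tail_le_lead (ha : a.Admissible) (h3 : a.a32 + a.a34 < a.a3)
    (h4 : a.a4 < a.a41 + a.a42) (h5 : a.a21 + a.a34 < a.a42 + a.a13) (i j : Fin 7)
    (hj : (a.tail j).degree = (a.lead j).degree) : ¬ a.tail j ≤ a.lead i := by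
  obtain ⟨⟨_, _⟩, ⟨_, _⟩, ⟨_, _⟩, ⟨_, _⟩, ⟨_, _⟩, ⟨_, _⟩, ⟨_, _⟩, ⟨_, _⟩⟩ := ha
  fin_cases j <;> simp [lead, tail, degree_eq_sum_four] at hj <;> fin_cases i <;>
    simp [lead, tail, expo_le_iff] <;> omega

end CurveExponents

namespace HasToricGenerators

variable {K : Type*} [Field K] {n : Fin 4 → ℕ} {a : CurveExponents}

theorem coeff_lead_initialForms_ne_zero (h : HasToricGenerators K n a)
    (hn : ∀ i, 0 < n i) (hmono : StrictMono n)
    (h5 : a.a21 + a.a34 < a.a42 + a.a13) (h2 : a.a2 ≤ a.a21 + a.a23) (i : Fin 7) :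
    coeff (a.lead i) (a.initialForms K i) ≠ 0 := by
  classical
  rw [CurveExponents.initialForms, coeff_sub, coeff_monomial, if_pos rfl]
  split_ifs with hd
  · rw [coeff_monomial, if_neg, sub_zero]
    · exact one_ne_zero
    · intro he
      exact CurveExponents.not_tail_le_lead h.admissible (h.lt_three hn h5 h2) (h.lt_four hmono) h5
        i i hd he.le
  · rw [coeff_zero, sub_zero]; exact one_ne_zero

theorem coeff_initialForms_of_le_lead (h : HasToricGenerators K n a)
    (hn : ∀ i, 0 < n i) (hmono : StrictMono n)
    (h5 : a.a21 + a.a34 < a.a42 + a.a13) (h2 : a.a2 ≤ a.a21 + a.a23) (i j : Fin 7)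
    {β : Fin 4 →₀ ℕ} (hβ : β ≤ a.lead i) (hne : j ≠ i ∨ β ≠ a.lead i) :
    coeff β (a.initialForms K j) = 0 := by
  refine CurveExponents.coeff_initialForms_eq_zero ?_ fun hd => ?_
  · rintro rfl
    rcases hne with hne | hne
    · exact CurveExponents.not_lead_le_lead h.admissible i j hne hβ
    · by_cases hij : j = i
      · exact hne (hij ▸ rfl)
      · exact CurveExponents.not_lead_le_lead h.admissible i j hij hβ
  · rintro rfl
    exact CurveExponents.not_tail_le_lead h.admissible (h.lt_three hn h5 h2) (h.lt_four hmono) h5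
      i j hd hβ

theorem minimallyGenerates_initialForms (h : HasToricGenerators K n a) (hn : ∀ i, 0 < n i)
    (hmono : StrictMono n) (h5 : a.a21 + a.a34 < a.a42 + a.a13) (h14 : a.a14 ≤ a.a34)
    (h2 : a.a2 ≤ a.a21 + a.a23) (h3 : a.a32 + a.a34 ≤ a.a3)
    (h6 : a.a3 + a.a13 ≤ a.a1 + a.a32 + (a.a34 - a.a14)) :
    MinimallyGenerates (a.initialForms K) (initialFormIdeal (toricIdeal K n)) :=
  ⟨h.span_initialForms hn hmono h5 h14 h2 h3 h6,
    notMem_span_of_exponents (h.coeff_lead_initialForms_ne_zero hn hmono h5 h2)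
      fun i j hij _ hβ => h.coeff_initialForms_of_le_lead hn hmono h5 h2 i j hβ (Or.inl hij)⟩

theorem spanFinrank_initialFormIdeal (h : HasToricGenerators K n a) (hn : ∀ i, 0 < n i)
    (hmono : StrictMono n) (h5 : a.a21 + a.a34 < a.a42 + a.a13) (h14 : a.a14 ≤ a.a34)
    (h2 : a.a2 ≤ a.a21 + a.a23) (h3 : a.a32 + a.a34 ≤ a.a3)
    (h6 : a.a3 + a.a13 ≤ a.a1 + a.a32 + (a.a34 - a.a14)) :
    (initialFormIdeal (toricIdeal K n)).spanFinrank = 7 := by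
  rw [← h.span_initialForms hn hmono h5 h14 h2 h3 h6]
  exact spanFinrank_span_range_eq_card (h.coeff_lead_initialForms_ne_zero hn hmono h5 h2)
    (fun i j hij _ hβ => h.coeff_initialForms_of_le_lead hn hmono h5 h2 i j hβ (Or.inl hij))
    fun i _ hβ => h.coeff_initialForms_of_le_lead hn hmono h5 h2 i i hβ.le (Or.inr hβ.ne)

/-! ### The tangent cone -/

/-- The `x_1`-axis lies on the tangent cone. -/
theorem aeval_axis_eq_zero (h : HasToricGenerators K n a) (hn : ∀ i, 0 < n i)
    (hmono : StrictMono n) (h5 : a.a21 + a.a34 < a.a42 + a.a13) (h14 : a.a14 ≤ a.a34)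
    (h2 : a.a2 ≤ a.a21 + a.a23) (h3 : a.a32 + a.a34 ≤ a.a3)
    (h6 : a.a3 + a.a13 ≤ a.a1 + a.a32 + (a.a34 - a.a14)) {f : MvPolynomial (Fin 4) K}
    (hf : f ∈ initialFormIdeal (toricIdeal K n)) :
    aeval ![(Polynomial.X : Polynomial K), 0, 0, 0] f = 0 := by
  obtain ⟨⟨_, _⟩, ⟨_, _⟩, ⟨_, _⟩, ⟨_, _⟩, ⟨_, _⟩, ⟨_, _⟩, ⟨_, _⟩, ⟨_, _⟩⟩ := h.admissible
  have h1 := h.lt_one hmono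
  have h3' := h.lt_three hn h5 h2
  have h4 := h.lt_four hmono
  rw [← h.span_initialForms hn hmono h5 h14 h2 h3 h6] at hf
  suffices hle : Ideal.span (Set.range (a.initialForms K)) ≤
      RingHom.ker (aeval ![(Polynomial.X : Polynomial K), 0, 0, 0]) from hle hf
  refine Ideal.span_le.mpr ?_
  rintro _ ⟨i, rfl⟩
  have key : ∀ p q r s : ℕ, 0 < q + r + s →
      aeval ![(Polynomial.X : Polynomial K), 0, 0, 0] (monomial (expo p q r s) (1 : K)) = 0 := by
    intro p q r s hpos
    rw [monomial_expo]
    have : q ≠ 0 ∨ r ≠ 0 ∨ s ≠ 0 := by omega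
    rcases this with h | h | h <;> simp [h]
  rw [SetLike.mem_coe, RingHom.mem_ker, CurveExponents.initialForms, map_sub]
  split_ifs with hd
  · have h7 := h.not_pure_f7 hmono h14
    fin_cases i <;> simp [CurveExponents.lead, CurveExponents.tail, degree_eq_sum_four] at hd ⊢ <;>
      rw [key _ _ _ _ (by omega), key _ _ _ _ (by omega), sub_zero]
  · rw [map_zero, sub_zero]
    fin_cases i <;> exact key _ _ _ _ (by omega)

/-- The monomial `x_4^{a_34}` is annihilated by powers of all variables on the tangent cone. -/
theorem exists_X_pow_mul_mem (h : HasToricGenerators K n a)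
    (hmono : StrictMono n) (h5 : a.a21 + a.a34 < a.a42 + a.a13) (i : Fin 4) :
    ∃ k, X i ^ k * monomial (expo 0 0 0 a.a34) (1 : K) ∈ initialFormIdeal (toricIdeal K n) := by
  have hlt : ∀ i, i ≠ 0 → n 0 < n i := fun i hi => hmono (Fin.pos_iff_ne_zero.mpr hi)
  by_cases hi : i = 0
  · subst hi
    refine ⟨a.a21, ?_⟩
    have := monomial_mem_initialFormIdeal (K := K) (n := n) (α := expo a.a21 0 0 a.a34)
      (β := expo 0 a.a42 a.a13 0) (by rw [weight_eq_wt, weight_eq_wt]; exact h.wt_f5)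
      (by simpa [degree_eq_sum_four] using h5)
    simpa [monomial_expo] using this
  -- For i ≠ 0 the binomial x_i^{n_1} - x_1^{n_i} lies in the toric ideal, and its first term has
  -- the smaller degree.
  · refine ⟨n 0, Ideal.mul_mem_right _ _ ?_⟩
    have := monomial_mem_initialFormIdeal (K := K) (n := n) (α := Finsupp.single i (n 0))
      (β := Finsupp.single 0 (n i))
      (by simp [Finsupp.weight_single, mul_comm]) (by simpa using hlt i hi)
    rwa [← X_pow_eq_monomial] at this

theorem not_isCohenMacaulay (h : HasToricGenerators K n a) (hn : ∀ i, 0 < n i)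
    (hmono : StrictMono n) (h5 : a.a21 + a.a34 < a.a42 + a.a13) (h14 : a.a14 ≤ a.a34)
    (h2 : a.a2 ≤ a.a21 + a.a23) (h3 : a.a32 + a.a34 ≤ a.a3)
    (h6 : a.a3 + a.a13 ≤ a.a1 + a.a32 + (a.a34 - a.a14)) :
    ¬ IsCohenMacaulay (MvPolynomial (Fin 4) K ⧸ initialFormIdeal (toricIdeal K n)) := by
  set J := initialFormIdeal (toricIdeal K n) with hJ
  have haxis : ∀ f ∈ J, (aeval ![(Polynomial.X : Polynomial K), 0, 0, 0] :
      MvPolynomial (Fin 4) K →ₐ[K] Polynomial K).toRingHom f = 0 := fun f hf =>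
    h.aeval_axis_eq_zero hn hmono h5 h14 h2 h3 h6 hf
  have hcomp : ∀ f : MvPolynomial (Fin 4) K, Polynomial.constantCoeff
      (aeval ![(Polynomial.X : Polynomial K), 0, 0, 0] f) = constantCoeff f := by
    intro f
    induction f using MvPolynomial.induction_on with
    | C c => simp
    | add p q hp hq => rw [map_add, map_add, map_add, hp, hq]
    | mul_X p i hp =>
      rw [map_mul, map_mul, map_mul, hp]
      fin_cases i <;> simp
  have horigin : ∀ f ∈ J, constantCoeff f = 0 := fun f hf => by
    rw [← hcomp f]
    exact (congrArg _ (haxis f hf)).trans (map_zero _)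
  have hp := RingHom.ker_isPrime (Ideal.Quotient.lift J constantCoeff horigin)
  have hq := RingHom.ker_isPrime (Ideal.Quotient.lift J _ haxis)
  -- p is the ideal of the origin and q that of the x_1-axis.
  refine not_isCohenMacaulay_of_torsion (p := RingHom.ker (Ideal.Quotient.lift J _ horigin))
    (q := RingHom.ker (Ideal.Quotient.lift J _ haxis)) ?_
    (z := Ideal.Quotient.mk J (monomial (expo 0 0 0 a.a34) 1)) ?_ ?_
  · refine lt_of_le_of_ne ?_ fun he => ?_
    · intro x hx
      obtain ⟨f, rfl⟩ := Ideal.Quotient.mk_surjective x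
      rw [RingHom.mem_ker, Ideal.Quotient.lift_mk] at hx ⊢
      rw [← hcomp f]
      exact (congrArg _ hx).trans (map_zero _)
    · have hx : Ideal.Quotient.mk J (X 0) ∈
          RingHom.ker (Ideal.Quotient.lift J constantCoeff horigin) := by
        rw [RingHom.mem_ker, Ideal.Quotient.lift_mk, constantCoeff_X]
      rw [← he, RingHom.mem_ker, Ideal.Quotient.lift_mk] at hx
      simp at hx
  · intro x hx
    obtain ⟨f, rfl⟩ := Ideal.Quotient.mk_surjective x
    rw [RingHom.mem_ker, Ideal.Quotient.lift_mk] at hx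
    have hf : f ∈ Ideal.span (X '' (Set.univ : Set (Fin 4))) := by
      rw [mem_ideal_span_X_image]
      intro m hm
      by_contra! hc
      have : m = 0 := Finsupp.ext fun i => hc i trivial
      rw [this, mem_support_iff] at hm
      exact hm hx
    -- The annihilator of z contains a power of each variable, so its radical contains every
    -- polynomial without constant term.
    have hrad : Ideal.span (X '' (Set.univ : Set (Fin 4))) ≤
        Ideal.radical (Submodule.comap (LinearMap.mulRight (MvPolynomial (Fin 4) K)
          (monomial (expo 0 0 0 a.a34) (1 : K))) J) := by
      refine Ideal.span_le.mpr ?_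
      rintro _ ⟨i, -, rfl⟩
      obtain ⟨k, hk⟩ := h.exists_X_pow_mul_mem hmono h5 i
      exact ⟨k, hk⟩
    obtain ⟨k, hk⟩ := hrad hf
    exact ⟨k, by rw [← map_pow, ← map_mul]; exact Ideal.Quotient.eq_zero_iff_mem.mpr hk⟩
  · intro x hx
    obtain ⟨f, rfl⟩ := Ideal.Quotient.mk_surjective x
    rw [RingHom.mem_ker, Ideal.Quotient.lift_mk] at hx
    rw [← map_mul, Ne, Ideal.Quotient.eq_zero_iff_mem]
    intro hmem
    apply hx
    rw [hJ, ← h.span_initialForms hn hmono h5 h14 h2 h3 h6] at hmem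
    have h34 := h.admissible.h34
    -- x_4^{a_34} strictly divides the leading monomial x_4^{a_4}, so its coefficient vanishes
    -- throughout J; in f · x_4^{a_34} that coefficient is the constant term of f.
    have hle : expo 0 0 0 a.a34 < a.lead 3 := by
      refine lt_of_le_of_ne ?_ fun he => ?_
      · simp [CurveExponents.lead, expo_le_iff, h34.2.le]
      · exact h34.2.ne (DFunLike.congr_fun he 3)
    have h0 := coeff_eq_zero_of_mem_span (D := fun β => β < a.lead 3)
      (fun α β hαβ => lt_of_le_of_lt le_add_self hαβ) (by
        rintro _ ⟨j, rfl⟩ β hβ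
        exact h.coeff_initialForms_of_le_lead hn hmono h5 h2 3 j hβ.le (Or.inr hβ.ne)) hmem hle
    have h1 := coeff_mul_monomial 0 (expo 0 0 0 a.a34) (1 : K) f
    rw [zero_add, h0, mul_one] at h1
    exact h1.symm

end HasToricGenerators

/-! ### Assembly of the eight cases -/

theorem theorem3p2 (K : Type*) [Field K] (n : Fin 4 → ℕ)
    (hpos : ∀ i, 0 < n i) (hmono : StrictMono n) (hgcd : Finset.univ.gcd n = 1)
    (a : CurveExponents) (hgen : HasToricGenerators K n a)
    (h5 : a.a21 + a.a34 < a.a42 + a.a13) (h14 : a.a14 ≤ a.a34)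
    (h2 : a.a2 ≤ a.a21 + a.a23) (h3 : a.a32 + a.a34 ≤ a.a3)
    (h6 : a.a3 + a.a13 ≤ a.a1 + a.a32 + (a.a34 - a.a14)) :
    -- standard basis, for the ordering with `x_4 > x_2 > x_3 > x_1`
    IsStandardBasis (NegDegRevLexLT ![3, 1, 2, 0])
      (Set.range ![a.f1 K, a.f2 K, a.f3 K, a.f4 K, a.f5 K, a.f6 K, a.f7 K])
      (toricIdeal K n) ∧
    -- the eight cases
    (a.a2 < a.a21 + a.a23 → a.a32 + a.a34 < a.a3 →
      a.a3 + a.a13 < a.a1 + a.a32 + (a.a34 - a.a14) →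
      MinimallyGenerates
        ![X 2 ^ a.a13 * X 3 ^ a.a14,
          X 1 ^ a.a2,
          X 1 ^ a.a32 * X 3 ^ a.a34,
          X 3 ^ a.a4,
          X 0 ^ a.a21 * X 3 ^ a.a34,
          X 2 ^ (a.a3 + a.a13),
          X 1 ^ a.a42 * X 2 ^ (2 * a.a13)]
        (initialFormIdeal (toricIdeal K n))) ∧
    (a.a2 < a.a21 + a.a23 → a.a32 + a.a34 < a.a3 →
      a.a3 + a.a13 = a.a1 + a.a32 + (a.a34 - a.a14) →
      MinimallyGenerates
        ![X 2 ^ a.a13 * X 3 ^ a.a14,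
          X 1 ^ a.a2,
          X 1 ^ a.a32 * X 3 ^ a.a34,
          X 3 ^ a.a4,
          X 0 ^ a.a21 * X 3 ^ a.a34,
          X 2 ^ (a.a3 + a.a13) - X 0 ^ a.a1 * X 1 ^ a.a32 * X 3 ^ (a.a34 - a.a14),
          X 1 ^ a.a42 * X 2 ^ (2 * a.a13)]
        (initialFormIdeal (toricIdeal K n))) ∧
    (a.a2 < a.a21 + a.a23 → a.a32 + a.a34 = a.a3 →
      a.a3 + a.a13 < a.a1 + a.a32 + (a.a34 - a.a14) →
      MinimallyGenerates
        ![X 2 ^ a.a13 * X 3 ^ a.a14,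
          X 1 ^ a.a2,
          X 2 ^ a.a3 - X 1 ^ a.a32 * X 3 ^ a.a34,
          X 3 ^ a.a4,
          X 0 ^ a.a21 * X 3 ^ a.a34,
          X 2 ^ (a.a3 + a.a13),
          X 1 ^ a.a42 * X 2 ^ (2 * a.a13)]
        (initialFormIdeal (toricIdeal K n))) ∧
    (a.a2 < a.a21 + a.a23 → a.a32 + a.a34 = a.a3 →
      a.a3 + a.a13 = a.a1 + a.a32 + (a.a34 - a.a14) →
      MinimallyGenerates
        ![X 2 ^ a.a13 * X 3 ^ a.a14,
          X 1 ^ a.a2,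
          X 2 ^ a.a3 - X 1 ^ a.a32 * X 3 ^ a.a34,
          X 3 ^ a.a4,
          X 0 ^ a.a21 * X 3 ^ a.a34,
          X 2 ^ (a.a3 + a.a13) - X 0 ^ a.a1 * X 1 ^ a.a32 * X 3 ^ (a.a34 - a.a14),
          X 1 ^ a.a42 * X 2 ^ (2 * a.a13)]
        (initialFormIdeal (toricIdeal K n))) ∧
    (a.a2 = a.a21 + a.a23 → a.a32 + a.a34 < a.a3 →
      a.a3 + a.a13 < a.a1 + a.a32 + (a.a34 - a.a14) →
      MinimallyGenerates
        ![X 2 ^ a.a13 * X 3 ^ a.a14,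
          X 1 ^ a.a2 - X 0 ^ a.a21 * X 2 ^ a.a23,
          X 1 ^ a.a32 * X 3 ^ a.a34,
          X 3 ^ a.a4,
          X 0 ^ a.a21 * X 3 ^ a.a34,
          X 2 ^ (a.a3 + a.a13),
          X 1 ^ a.a42 * X 2 ^ (2 * a.a13)]
        (initialFormIdeal (toricIdeal K n))) ∧
    (a.a2 = a.a21 + a.a23 → a.a32 + a.a34 < a.a3 →
      a.a3 + a.a13 = a.a1 + a.a32 + (a.a34 - a.a14) →
      MinimallyGenerates
        ![X 2 ^ a.a13 * X 3 ^ a.a14,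
          X 1 ^ a.a2 - X 0 ^ a.a21 * X 2 ^ a.a23,
          X 1 ^ a.a32 * X 3 ^ a.a34,
          X 3 ^ a.a4,
          X 0 ^ a.a21 * X 3 ^ a.a34,
          X 2 ^ (a.a3 + a.a13) - X 0 ^ a.a1 * X 1 ^ a.a32 * X 3 ^ (a.a34 - a.a14),
          X 0 ^ (a.a1 + a.a21) * X 3 ^ (a.a34 - a.a14) - X 1 ^ a.a42 * X 2 ^ (2 * a.a13)]
        (initialFormIdeal (toricIdeal K n))) ∧
    (a.a2 = a.a21 + a.a23 → a.a32 + a.a34 = a.a3 →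
      a.a3 + a.a13 < a.a1 + a.a32 + (a.a34 - a.a14) →
      MinimallyGenerates
        ![X 2 ^ a.a13 * X 3 ^ a.a14,
          X 1 ^ a.a2 - X 0 ^ a.a21 * X 2 ^ a.a23,
          X 2 ^ a.a3 - X 1 ^ a.a32 * X 3 ^ a.a34,
          X 3 ^ a.a4,
          X 0 ^ a.a21 * X 3 ^ a.a34,
          X 2 ^ (a.a3 + a.a13),
          X 1 ^ a.a42 * X 2 ^ (2 * a.a13)]
        (initialFormIdeal (toricIdeal K n))) ∧
    (a.a2 = a.a21 + a.a23 → a.a32 + a.a34 = a.a3 →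
      a.a3 + a.a13 = a.a1 + a.a32 + (a.a34 - a.a14) →
      MinimallyGenerates
        ![X 2 ^ a.a13 * X 3 ^ a.a14,
          X 1 ^ a.a2 - X 0 ^ a.a21 * X 2 ^ a.a23,
          X 2 ^ a.a3 - X 1 ^ a.a32 * X 3 ^ a.a34,
          X 3 ^ a.a4,
          X 0 ^ a.a21 * X 3 ^ a.a34,
          X 2 ^ (a.a3 + a.a13) - X 0 ^ a.a1 * X 1 ^ a.a32 * X 3 ^ (a.a34 - a.a14),
          X 0 ^ (a.a1 + a.a21) * X 3 ^ (a.a34 - a.a14) - X 1 ^ a.a42 * X 2 ^ (2 * a.a13)]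
        (initialFormIdeal (toricIdeal K n))) ∧
    -- the minimal number of generators is seven, and the tangent cone is not Cohen-Macaulay
    (initialFormIdeal (toricIdeal K n)).spanFinrank = 7 ∧
    ¬ IsCohenMacaulay (MvPolynomial (Fin 4) K ⧸ initialFormIdeal (toricIdeal K n)) := by
  have hB := hgen.minimallyGenerates_initialForms hpos hmono h5 h14 h2 h3 h6
  have h3' := hgen.lt_three hpos h5 h2
  have i0 := CurveExponents.initialForms_zero (K := K) (hgen.lt_one hmono)
  have i2 := CurveExponents.initialForms_two (K := K) h3'
  have i3 := CurveExponents.initialForms_three (K := K) (hgen.lt_four hmono)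
  have i4 := CurveExponents.initialForms_four (K := K) h5
  obtain ⟨r1, r2, r3, r4⟩ := hgen.relations hpos
  refine ⟨?_, fun c2 c3 c6 => ?_, fun c2 c3 c6 => ?_, fun c2 c3 c6 => ?_, fun c2 c3 c6 => ?_,
    fun c2 c3 c6 => ?_, fun c2 c3 c6 => ?_, fun c2 c3 c6 => ?_, fun c2 c3 c6 => ?_,
    hgen.spanFinrank_initialFormIdeal hpos hmono h5 h14 h2 h3 h6,
    hgen.not_isCohenMacaulay hpos hmono h5 h14 h2 h3 h6⟩
  · refine isStandardBasis_of_injOn (fun i => (hpos i).ne') (by decide) (hgen.weight_tail h14)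
      (hgen.tail_lt_lead hpos hmono h5 h2 h3 h6) (hgen.eq_of_irreducible hpos h14) fun i => ?_
    fin_cases i
    · right; simp [CurveExponents.lead, CurveExponents.tail, monomial_expo, CurveExponents.f1]
    · left; simp [CurveExponents.lead, CurveExponents.tail, monomial_expo, CurveExponents.f2]
    · right; simp [CurveExponents.lead, CurveExponents.tail, monomial_expo, CurveExponents.f3]
    · left; simp [CurveExponents.lead, CurveExponents.tail, monomial_expo, CurveExponents.f4]
    · left; simp [CurveExponents.lead, CurveExponents.tail, monomial_expo, CurveExponents.f5]
    · left; simp [CurveExponents.lead, CurveExponents.tail, monomial_expo, CurveExponents.f6]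
    · right; simp [CurveExponents.lead, CurveExponents.tail, monomial_expo, CurveExponents.f7]
  · have i1 := CurveExponents.initialForms_one (K := K) c2
    have i5 := CurveExponents.initialForms_five (K := K) c6
    have i6 := CurveExponents.initialForms_six (K := K) (a := a) (by omega)
    refine hB.of_neg fun i => ?_
    fin_cases i
    · left; exact i0.symm
    · left; exact i1.symm
    · left; exact i2.symm
    · left; exact i3.symm
    · left; exact i4.symm
    · left; exact i5.symm
    · left; exact i6.symm
  · have i1 := CurveExponents.initialForms_one (K := K) c2
    have i5 := CurveExponents.initialForms_five' (K := K) c6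
    have i6 := CurveExponents.initialForms_six (K := K) (a := a) (by omega)
    refine hB.of_neg fun i => ?_
    fin_cases i
    · left; exact i0.symm
    · left; exact i1.symm
    · left; exact i2.symm
    · left; exact i3.symm
    · left; exact i4.symm
    · left; exact i5.symm
    · left; exact i6.symm
  -- Homogeneity of f_3 contradicts `h3'`, so cases 3 and 4, and likewise 7 and 8, are vacuous.
  · omega
  · omega
  · have i1 := CurveExponents.initialForms_one' (K := K) c2
    have i5 := CurveExponents.initialForms_five (K := K) c6
    have i6 := CurveExponents.initialForms_six (K := K) (a := a) (by omega)
    refine hB.of_neg fun i => ?_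
    fin_cases i
    · left; exact i0.symm
    · left; exact i1.symm
    · left; exact i2.symm
    · left; exact i3.symm
    · left; exact i4.symm
    · left; exact i5.symm
    · left; exact i6.symm
  · have i1 := CurveExponents.initialForms_one' (K := K) c2
    have i5 := CurveExponents.initialForms_five' (K := K) c6
    have i6 := CurveExponents.initialForms_six' (K := K) (a := a) (by omega)
    refine hB.of_neg fun i => ?_
    fin_cases i
    · left; exact i0.symm
    · left; exact i1.symm
    · left; exact i2.symm
    · left; exact i3.symm
    · left; exact i4.symm
    · left; exact i5.symm
    · right; exact (congrArg Neg.neg i6).trans (neg_sub _ _) |>.symm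
  · omega
  · omega
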